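/- Let $p$ be an odd prime, let $L/K$ be a separable field extension of degree $p^2$ with normal closure $\widetilde L$, and let $G=\mathrm{Gal}(\widetilde L/K)$. A Hopf Galois structure on $L/K$ is a pair $(H,\mu)$, where $H$ is a finite-dimensional cocommutative $K$-Hopf algebra and $\mu\colon H\to\mathrm{End}_K(L)$ makes $L$ a left $H$-module algebra such that the $K$-linear map $L\otimes_K H\to\mathrm{End}_K(L)$, $s\otimes h\mapsto\bigl(t\mapsto s\,\mu(h)(t)\bigr)$, is bijective. Two such structures are identified if there is an isomorphism of $K$-Hopf algebras compatible with the actions on $L$. The structure is of cyclic type if $\widetilde L\otimes_K H\cong\widetilde L[C_{p^2}]$ as $\widetilde L$-Hopf algebras, where $C_n$ denotes the cyclic group of order $n$. Then $L/K$ has a Hopf Galois structure of cyclic type if and only if $G$ is isomorphic to a semidirect product $C_{p^2}\rtimes_\varphi C_m$ for some divisor $m$ of $p(p-1)$ and some homomorphism $\varphi\colon C_m\to\mathrm{Aut}(C_{p^2})$. Moreover, whenever $G\cong C_{p^2}\rtimes_\varphi C_m$ with $m\mid p(p-1)$, the action $\varphi$ is faithful, and the number of isomorphism classes of Hopf Galois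 structures of cyclic type on $L/K$ is $p$ if $m=1$ or $m=p$, and $1$ otherwise. -/

import Mathlib

open scoped TensorProduct

universe u v w

noncomputable section

/-- A Hopf Galois structure on a field extension `L/K`: a finite cocommutative `K`-Hopf algebra `H`
together with a Hopf action of `H` on `L`, that is, a left `H`-module algebra structure on `L` such
that the `K`-linear map `L ⊗ H → End_K(L)`, `s ⊗ h ↦ (t ↦ s * (h • t))` is bijective.
Such an `H` embeds in `End_K(L)`, so nothing is lost by letting it live in the universe of `L`. -/
structure HopfGaloisStructure (K : Type u) (L : Type v) [Field K] [Field L] [Algebra K L] where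
  /-- The underlying type of the Hopf algebra `H`. -/
  H : Type v
  [ring : Ring H]
  [hopf : HopfAlgebra K H]
  [cocomm : Coalgebra.IsCocomm K H]
  [finite : Module.Finite K H]
  /-- The `H`-module structure of `L`, as a `K`-algebra homomorphism `H → End_K(L)`. -/
  action : H →ₐ[K] Module.End K L
  /-- `h • 1 = ε(h) 1`. -/
  action_one : ∀ h : H, action h 1 = algebraMap K L (Coalgebra.counit (R := K) h)
  /-- `h • (x y) = ∑ (h₁ • x) (h₂ • y)`, where `Δ h = ∑ h₁ ⊗ h₂`. -/
  action_mul : ∀ (h : H) (x y : L), action h (x * y) =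
    LinearMap.mul' K L (TensorProduct.map (action.toLinearMap.flip x) (action.toLinearMap.flip y)
      (Coalgebra.comul (R := K) h))
  /-- `L ⊗ H → End_K(L)` is an isomorphism. -/
  bijective : Function.Bijective
    (TensorProduct.lift (((LinearMap.mul K (Module.End K L)).comp
      (Algebra.lmul K L).toLinearMap).compl₂ action.toLinearMap) :
        L ⊗[K] H →ₗ[K] Module.End K L)

namespace HopfGaloisStructure

variable {K : Type u} {L : Type v} [Field K] [Field L] [Algebra K L]

attribute [instance] ring hopf cocomm finite

/-- Two Hopf Galois structures are isomorphic if there is an isomorphism of `K`-Hopf algebras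
compatible with the actions on `L`. (An isomorphism of bialgebras preserves antipodes.) -/
def Iso (S T : HopfGaloisStructure K L) : Prop :=
  ∃ e : S.H ≃ₐc[K] T.H, ∀ h : S.H, T.action (e h) = S.action h

theorem iso_equivalence : Equivalence (Iso (K := K) (L := L)) where
  refl S := ⟨BialgEquiv.refl K S.H, fun _ => rfl⟩
  symm := by
    rintro S T ⟨e, he⟩
    refine ⟨e.symm, fun h => ?_⟩
    rw [← he]
    congr 1
    exact e.toEquiv.apply_symm_apply h
  trans := by
    rintro S T U ⟨e, he⟩ ⟨f, hf⟩
    exact ⟨e.trans f, fun h => (hf (e h)).trans (he h)⟩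

/-- Isomorphism of Hopf Galois structures, as a setoid. -/
instance isoSetoid (K : Type u) (L : Type v) [Field K] [Field L] [Algebra K L] :
    Setoid (HopfGaloisStructure K L) :=
  ⟨Iso, iso_equivalence⟩

/-- The Hopf Galois structure has type `N`: over the normal closure `M` of `L/K` its Hopf algebra
becomes the group algebra of `N`, that is, `M ⊗ H ≅ M[N]` as Hopf algebras over `M`. -/
def HasType (S : HopfGaloisStructure K L) (M : Type w) [Field M] [Algebra K M]
    (N : Type*) [Group N] : Prop :=
  Nonempty ((M ⊗[K] S.H) ≃ₐc[M] MonoidAlgebra M N)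

/-- The number of Hopf Galois structures of type `N` on `L/K`, up to isomorphism, where `M` is the
normal closure of `L/K`. -/
def numberOfType (K : Type u) (L : Type v) [Field K] [Field L] [Algebra K L]
    (M : Type w) [Field M] [Algebra K M] (N : Type*) [Group N] : ℕ :=
  Nat.card {c : Quotient (isoSetoid K L) //
    ∃ S : HopfGaloisStructure K L, Quotient.mk (isoSetoid K L) S = c ∧ S.HasType M N}

end HopfGaloisStructure

/-- The cyclic group of order `n` (for `n ≠ 0`), written multiplicatively. -/
abbrev CyclicGrp (n : ℕ) : Type := Multiplicative (ZMod n)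

end

/-! The proof combines Greither–Pareigis theory with affine geometry over `ℤ/p²`. Let `X` be the set
of `K`-embeddings of `L` into the normal closure `M`. It has `p²` points, and `G = Gal(M/K)` acts on
it faithfully and transitively. For abelian `N` of order `[L : K]`, structures of type `N`
correspond to regular subgroups of `Perm X` isomorphic to `N` and normalised by `G`
(`exists_hasType_iff`, `numberOfType_eq_card`). A regular subgroup gives the Hopf algebra of those
`T ∈ End_K(L)` that act on embeddings through `M[N]`; it is a `K`-form of `M[N]` by Galois descent.
Conversely, the group-like elements of `M ⊗ H` permute `X`. A structure is determined up to
isomorphism by the image of `H` in `End_K(L)`.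

If a cyclic regular subgroup is normalised by `G`, it identifies `X` with `ℤ/p²` and makes `G` a
transitive group of affine maps. The elements with linear part `1` modulo `p` form a transitive
normal subgroup. Either this contains a nontrivial homothety, and then also the translation by `1`,
or it is generated by a single map `tau d : z ↦ (1 + d) z + 1` with `p d = 0`. In both cases `G` has
a normal regular cyclic subgroup (`exists_normal_zpowers`). The stabiliser of `0` is a complement
and embeds in the cyclic group `(ℤ/p²)ˣ`. Conversely, the factor `C_{p²}` of a semidirect product is
itself regular (`existsUnique_inl_apply`).

For the count, choose coordinates in which that factor acts by translations. The regular cyclic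
subgroups normalised by translation by `1` are then the `p` groups `⟨tau d⟩`
(`exists_eq_zpowers_tau`), and `G` normalises `⟨tau d⟩` iff `(a - 1) d = 0` for every linear part
`a` (`conj_tau_mem_iff`). So all `p` survive if every `a` is `1` modulo `p`, that is if `m ∣ p`, and
otherwise only `d = 0` does. -/

noncomputable section

/-! ### Galois action on embeddings, and linear descent from `M` to `K`. -/

section Embeddings

variable {K : Type u} {L : Type v} {M : Type w} [Field K] [Field L] [Field M]
  [Algebra K L] [Algebra K M]

/-- The permutation action of `Gal(M/K)` on the `K`-embeddings of `L` into `M`. -/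
def galPerm (K : Type u) (L : Type v) (M : Type w) [Field K] [Field L] [Field M]
    [Algebra K L] [Algebra K M] : Gal(M/K) →* Equiv.Perm (L →ₐ[K] M) where
  toFun σ :=
    { toFun := fun x => (σ : M →ₐ[K] M).comp x
      invFun := fun x => ((σ⁻¹ : Gal(M/K)) : M →ₐ[K] M).comp x
      left_inv := fun x => by ext l; exact σ.symm_apply_apply _
      right_inv := fun x => by ext l; exact σ.apply_symm_apply _ }
  map_one' := by ext; rfl
  map_mul' _ _ := by ext; rfl

@[simp] theorem galPerm_apply (σ : Gal(M/K)) (x : L →ₐ[K] M) (l : L) :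
    galPerm K L M σ x l = σ (x l) := rfl

theorem galPerm_inv_apply (σ : Gal(M/K)) (x : L →ₐ[K] M) (l : L) :
    ((galPerm K L M σ)⁻¹ x) l = σ⁻¹ (x l) := rfl

theorem card_embeddings [FiniteDimensional K L] [Algebra.IsSeparable K L]
    [IsNormalClosure K L M] : Nat.card (L →ₐ[K] M) = Module.finrank K L := by
  rw [Nat.card_eq_fintype_card]
  exact AlgHom.card_of_splits K L M (fun x => IsNormalClosure.splits x)

theorem galPerm_transitive [IsNormalClosure K L M] [Algebra.IsAlgebraic K L]
    (x y : L →ₐ[K] M) : ∃ σ, galPerm K L M σ x = y := by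
  have : Normal K M := IsNormalClosure.normal (K := L)
  let χ : x.fieldRange ≃ₐ[K] y.fieldRange :=
    (AlgEquiv.ofInjectiveField x).symm.trans (AlgEquiv.ofInjectiveField y)
  refine ⟨χ.liftNormal M, ?_⟩
  ext l
  have := χ.liftNormal_commutes M (AlgEquiv.ofInjectiveField x l)
  have h2 : χ (AlgEquiv.ofInjectiveField x l) = AlgEquiv.ofInjectiveField y l :=
    congrArg (AlgEquiv.ofInjectiveField y) ((AlgEquiv.ofInjectiveField x).symm_apply_apply l)
  rw [h2] at this
  exact this

theorem iSup_fieldRange [IsNormalClosure K L M] [Algebra.IsAlgebraic K L] :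
    ⨆ f : L →ₐ[K] M, f.fieldRange = ⊤ :=
  (Algebra.IsAlgebraic.isNormalClosure_iff.mp ‹_›).2

/-- An automorphism fixing every embedding fixes the compositum of their images, which is `M`. -/
theorem galPerm_injective [IsNormalClosure K L M] [Algebra.IsAlgebraic K L] :
    Function.Injective (galPerm K L M) := by
  rw [injective_iff_map_eq_one]
  intro σ h
  have : (⊤ : IntermediateField K M) ≤ IntermediateField.fixedField (Subgroup.zpowers σ) := by
    rw [← iSup_fieldRange (K := K) (L := L)]
    refine iSup_le fun f => ?_
    rintro _ ⟨l, rfl⟩ ⟨g, k, rfl⟩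
    have hk : galPerm K L M (σ ^ k) = 1 := by rw [map_zpow, h, one_zpow]
    exact DFunLike.congr_fun (DFunLike.congr_fun hk f) l
  ext m
  exact this (IntermediateField.mem_top (x := m)) ⟨σ, Subgroup.mem_zpowers σ⟩

theorem finiteDimensional_normalClosure [IsNormalClosure K L M] [FiniteDimensional K L] :
    FiniteDimensional K M := by
  have h : (⊤ : IntermediateField K M) = IntermediateField.normalClosure K L M :=
    iSup_fieldRange.symm
  have : FiniteDimensional K (⊤ : IntermediateField K M) := by
    rw [h]; infer_instance
  exact Module.Finite.equiv (IntermediateField.topEquiv (F := K) (E := M)).toLinearEquiv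

theorem isGalois_normalClosure [IsNormalClosure K L M] [Algebra.IsSeparable K L] :
    IsGalois K M := by
  have : Normal K M := IsNormalClosure.normal (K := L)
  have : Algebra.IsSeparable K M := by
    have h : (⊤ : IntermediateField K M) = ⨆ f : L →ₐ[K] M, f.fieldRange :=
      iSup_fieldRange.symm
    have : Algebra.IsSeparable K (⊤ : IntermediateField K M) := by
      rw [h]
      have : ∀ f : L →ₐ[K] M, Algebra.IsSeparable K f.fieldRange := fun f =>
        (AlgEquiv.Algebra.isSeparable (AlgEquiv.ofInjectiveField f))
      infer_instance
    exact AlgEquiv.Algebra.isSeparable (IntermediateField.topEquiv (F := K) (E := M))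
  exact ⟨⟩

/-- An equivariant function on the embeddings is evaluation at an element of `L`. -/
theorem exists_eval_of_equivariant [FiniteDimensional K L] [FiniteDimensional K M] [IsGalois K M]
    [IsNormalClosure K L M] (g : (L →ₐ[K] M) → M)
    (hg : ∀ σ x, g (galPerm K L M σ x) = σ (g x)) : ∃ t : L, ∀ x, g x = x t := by
  rcases isEmpty_or_nonempty (L →ₐ[K] M) with h | ⟨⟨x₀⟩⟩
  · exact ⟨0, fun x => h.elim x⟩
  -- By equivariance the value at `x₀` is fixed by `Gal(M/x₀(L))`, so it lies in `x₀(L)`;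
  -- transitivity then propagates the equality to all embeddings.
  have hx : g x₀ ∈ IntermediateField.fixedField x₀.fieldRange.fixingSubgroup := by
    rintro ⟨σ, hσ⟩
    have : galPerm K L M σ x₀ = x₀ := by
      ext l
      exact (mem_fixingSubgroup_iff _).mp hσ (x₀ l) ⟨l, rfl⟩
    change σ (g x₀) = g x₀
    rw [← hg, this]
  rw [IsGalois.fixedField_fixingSubgroup] at hx
  obtain ⟨t, ht⟩ := hx
  refine ⟨t, fun x => ?_⟩
  obtain ⟨σ, rfl⟩ := galPerm_transitive x₀ x
  rw [hg, galPerm_apply]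
  exact congrArg σ ht.symm

theorem algHom_linearIndependent : LinearIndependent M
    (fun x : L →ₐ[K] M => (fun l => x l : L → M)) :=
  (linearIndependent_monoidHom L M).comp (fun x : L →ₐ[K] M => (x : L →* M)) fun x y h => by
    ext l; exact DFunLike.congr_fun h l

theorem algEquiv_eq_zero_of_sum {ι : Type*} [Fintype ι] (s : ι → Gal(M/K))
    (hs : Function.Injective s) (c : ι → M) (h : ∀ a : M, ∑ i, s i a * c i = 0) (i : ι) :
    c i = 0 := by
  have := (linearIndependent_monoidHom M M).comp (fun i => ((s i : M →ₐ[K] M) : M →* M))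
    (fun i j h => hs (by ext m; exact DFunLike.congr_fun h m))
  rw [Fintype.linearIndependent_iff] at this
  refine this c (funext fun a => ?_) i
  simpa [Finset.sum_apply, mul_comm] using h a

/-- The function `(x, b) ↦ x (t b)` attached to `t : B → L`. -/
def evalMap (K : Type u) (L : Type v) (M : Type w) [Field K] [Field L] [Field M]
    [Algebra K L] [Algebra K M] (B : Type*) : (B → L) →ₗ[K] ((L →ₐ[K] M) → B → M) where
  toFun t x b := x (t b)
  map_add' _ _ := by ext; simp
  map_smul' _ _ := by ext; simp

@[simp] theorem evalMap_apply {B : Type*} (t : B → L) (x : L →ₐ[K] M) (b : B) :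
    evalMap K L M B t x b = x (t b) := rfl

theorem evalMap_linearIndependent [FiniteDimensional K M] [IsGalois K M]
    [Nonempty (L →ₐ[K] M)] {B ι : Type*} (t : ι → B → L)
    (ht : LinearIndependent K t) : LinearIndependent M (fun i => evalMap K L M B (t i)) := by
  rw [linearIndependent_iff'] at ht ⊢
  intro s a h i hi
  -- Multiplying an `M`-relation by `m` and taking traces yields a `K`-relation; nondegeneracy of
  -- the trace form then kills the coefficients.
  have key : ∀ m : M, Algebra.trace K M (m * a i) = 0 := by
    intro m
    refine ht s (fun i => Algebra.trace K M (m * a i)) (funext fun b => ?_) i hi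
    obtain ⟨x⟩ := ‹Nonempty (L →ₐ[K] M)›
    apply x.injective
    change x ((∑ i ∈ s, Algebra.trace K M (m * a i) • t i) b) = x 0
    simp only [Finset.sum_apply, Pi.smul_apply, map_sum, map_smul, map_zero]
    simp only [Algebra.smul_def, trace_eq_sum_automorphisms, map_mul, Finset.sum_mul]
    rw [Finset.sum_comm]
    refine Finset.sum_eq_zero fun σ _ => ?_
    have := congrArg σ (congrFun (congrFun h ((galPerm K L M σ)⁻¹ x)) b)
    simp only [Finset.sum_apply, Pi.smul_apply, evalMap_apply, galPerm_inv_apply, smul_eq_mul,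
      map_sum, map_mul, Pi.zero_apply, map_zero] at this
    have h2 : ∀ y, σ (σ⁻¹ y) = y := fun y => σ.apply_symm_apply y
    simp only [h2] at this
    simp only [mul_assoc, ← Finset.mul_sum, this, mul_zero]
  exact (traceForm_nondegenerate K M).1 (a i) fun m => by
    rw [Algebra.traceForm_apply, mul_comm]; exact key m

/-- Extending scalars creates no new `K`-rational solutions: if `t ∉ R`, then `t` together with a
basis of `R` stays independent over `M`. -/
theorem mem_of_evalMap_mem_span [FiniteDimensional K M] [IsGalois K M]
    [Nonempty (L →ₐ[K] M)] {B : Type*} (R : Submodule K (B → L)) (t : B → L)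
    (h : evalMap K L M B t ∈ Submodule.span M (evalMap K L M B '' R)) : t ∈ R := by
  by_contra ht
  let b := Module.Basis.ofVectorSpace K R
  have hb : LinearIndependent K (fun i => (b i : B → L)) :=
    b.linearIndependent.map' R.subtype (Submodule.ker_subtype R)
  have hspan : Submodule.span K (Set.range fun i => (b i : B → L)) = R := by
    have := b.span_eq
    have h2 := congrArg (Submodule.map R.subtype) this
    rw [Submodule.map_span, ← Set.range_comp, Submodule.map_top, Submodule.range_subtype] at h2
    exact h2
  have hc := hb.option (x := t) (by rwa [hspan])
  have hM := evalMap_linearIndependent (M := M) _ hc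
  rw [linearIndependent_option] at hM
  apply hM.2
  refine (Submodule.span_le.2 ?_ : _ ≤ _) h
  rintro _ ⟨r, hr, rfl⟩
  rw [← hspan] at hr
  have : r ∈ ((Submodule.span M (Set.range ((fun i => evalMap K L M B
      (Option.casesOn' i t fun i => (b i : B → L))) ∘ some))).restrictScalars K).comap
        (evalMap K L M B) := by
    refine (Submodule.span_le.2 ?_ : _ ≤ _) hr
    rintro _ ⟨i, rfl⟩
    exact Submodule.subset_span ⟨i, rfl⟩
  exact this

end Embeddings

/-! ### Hopf algebra structures on `K`-forms of commutative `M`-Hopf algebras. -/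

section Descent

open Algebra.TensorProduct

variable {K M : Type*} [Field K] [Field M] [Algebra K M]

theorem exists_algHom_lift {A B C : Type*} [Semiring A] [Semiring B] [Semiring C] [Algebra K A]
    [Algebra K B] [Algebra K C] (i : B →ₐ[K] C) (hi : Function.Injective i) (f : A →ₐ[K] C)
    (h : ∀ a, f a ∈ i.range) : ∃ g : A →ₐ[K] B, ∀ a, i (g a) = f a :=
  ⟨(AlgEquiv.ofInjective i hi).symm.toAlgHom.comp (f.codRestrict i.range h), fun a =>
    congrArg Subtype.val ((AlgEquiv.ofInjective i hi).apply_symm_apply ⟨f a, h a⟩)⟩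

variable {R₁ R₂ B₁ B₂ : Type*} [CommRing R₁] [CommRing R₂] [CommRing B₁] [CommRing B₂]
  [Algebra K R₁] [Algebra K R₂] [Algebra K B₁] [Algebra K B₂] [Algebra M B₁] [Algebra M B₂]
  [IsScalarTower K M B₁] [IsScalarTower K M B₂]

/-- The map `R₁ ⊗ R₂ → B₁ ⊗ B₂` induced by two algebra homomorphisms over different base fields. -/
def semiMap (M : Type*) [Field M] [Algebra K M] [Algebra M B₁] [Algebra M B₂]
    [IsScalarTower K M B₁] [IsScalarTower K M B₂] (f : R₁ →ₐ[K] B₁) (g : R₂ →ₐ[K] B₂) :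
    R₁ ⊗[K] R₂ →ₐ[K] B₁ ⊗[M] B₂ :=
  lift (((includeLeft : B₁ →ₐ[M] B₁ ⊗[M] B₂).restrictScalars K).comp f)
    (((includeRight : B₂ →ₐ[M] B₁ ⊗[M] B₂).restrictScalars K).comp g) fun _ _ => .all _ _

@[simp] theorem semiMap_tmul (f : R₁ →ₐ[K] B₁) (g : R₂ →ₐ[K] B₂) (a : R₁) (b : R₂) :
    semiMap M f g (a ⊗ₜ b) = f a ⊗ₜ g b := by
  simp [semiMap]

/-- An algebra homomorphism from a `K`-algebra to an `M`-algebra taking some `K`-basis to an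
`M`-linearly independent family. -/
def IsIndep (M : Type*) [Field M] [Algebra K M] [Algebra M B₁] (f : R₁ →ₐ[K] B₁) : Prop :=
  ∃ (ι : Type) (b : Module.Basis ι K R₁), LinearIndependent M fun i => f (b i)

theorem IsIndep.injective {f : R₁ →ₐ[K] B₁} (hf : IsIndep M f) : Function.Injective f := by
  obtain ⟨ι, b, hb⟩ := hf
  have h := hb.restrict_scalars (R := K) (smul_left_injective K one_ne_zero)
  rw [injective_iff_map_eq_zero]
  intro a ha
  have h3 : Function.Injective (f.toLinearMap ∘ₗ b.repr.symm.toLinearMap) := by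
    have : f.toLinearMap ∘ₗ b.repr.symm.toLinearMap
        = Finsupp.linearCombination K (fun i => f (b i)) := by
      ext i; simp
    rw [this]; exact h
  have : b.repr a = 0 := h3 (by simpa using ha)
  simpa using this

theorem IsIndep.tmul {f : R₁ →ₐ[K] B₁} {g : R₂ →ₐ[K] B₂} (hf : IsIndep M f)
    (hg : IsIndep M g) : IsIndep M (semiMap M f g) := by
  obtain ⟨ι, b, hb⟩ := hf
  obtain ⟨κ, c, hc⟩ := hg
  refine ⟨ι × κ, b.tensorProduct c, ?_⟩
  have h : ∀ i : ι × κ, semiMap M f g (b.tensorProduct c i) = f (b i.1) ⊗ₜ[M] g (c i.2) :=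
    fun i => by rw [Module.Basis.tensorProduct_apply', semiMap_tmul]
  have h2 := hb.tmul_of_isDomain hc
  rw [funext h]
  exact h2

variable {R B : Type*} [CommRing R] [CommRing B] [Algebra K R] [Algebra K B] [HopfAlgebra M B]
  [IsScalarTower K M B]

/-- A `K`-form of a commutative `M`-Hopf algebra `B`. -/
structure IsHopfForm (M : Type*) [Field M] [Algebra K M] [HopfAlgebra M B]
    [IsScalarTower K M B] (j : R →ₐ[K] B) : Prop where
  indep : IsIndep M j
  span : Submodule.span M (Set.range j) = ⊤
  comul_mem : ∀ r, Coalgebra.comul (R := M) (j r) ∈ (semiMap M j j).range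
  counit_mem : ∀ r, Coalgebra.counit (R := M) (j r) ∈ (Algebra.ofId K M).range
  antipode_mem : ∀ r, HopfAlgebra.antipode M (j r) ∈ j.range

namespace IsHopfForm

variable {j : R →ₐ[K] B} (hj : IsHopfForm M j)
include hj

theorem exists_comul : ∃ Δ : R →ₐ[K] R ⊗[K] R, ∀ r,
    semiMap M j j (Δ r) = Coalgebra.comul (R := M) (j r) :=
  exists_algHom_lift _ (hj.indep.tmul hj.indep).injective
    (((Bialgebra.comulAlgHom M B).restrictScalars K).comp j) hj.comul_mem

theorem exists_counit : ∃ ε : R →ₐ[K] K, ∀ r,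
    algebraMap K M (ε r) = Coalgebra.counit (R := M) (j r) :=
  exists_algHom_lift (Algebra.ofId K M) (algebraMap K M).injective
    (((Bialgebra.counitAlgHom M B).restrictScalars K).comp j) hj.counit_mem

theorem exists_antipode : ∃ S : R →ₐ[K] R, ∀ r, j (S r) = HopfAlgebra.antipode M (j r) :=
  exists_algHom_lift j hj.indep.injective
    (((HopfAlgebra.antipodeAlgHom M B).restrictScalars K).comp j) hj.antipode_mem

omit hj in
theorem semiMap_map_id_comul {Δ : R →ₐ[K] R ⊗[K] R}
    (hΔ : ∀ r, semiMap M j j (Δ r) = Coalgebra.comul (R := M) (j r)) (u : R ⊗[K] R) :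
    semiMap M j (semiMap M j j) (map (.id K R) Δ u) =
      (Coalgebra.comul (R := M)).lTensor B (semiMap M j j u) := by
  induction u with
  | zero => simp
  | add x y hx hy => simp only [map_add, hx, hy]
  | tmul x y => simp [hΔ]

omit hj in
theorem semiMap_assoc_tmul (u : R ⊗[K] R) (r : R) :
    semiMap M j (semiMap M j j) (Algebra.TensorProduct.assoc K K K R R R (u ⊗ₜ r)) =
      TensorProduct.assoc M B B B (semiMap M j j u ⊗ₜ j r) := by
  induction u with
  | zero => simp
  | add x y hx hy => simp only [map_add, TensorProduct.add_tmul, hx, hy]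
  | tmul x y => simp

omit hj in
theorem semiMap_assoc_map_comul_id {Δ : R →ₐ[K] R ⊗[K] R}
    (hΔ : ∀ r, semiMap M j j (Δ r) = Coalgebra.comul (R := M) (j r)) (u : R ⊗[K] R) :
    semiMap M j (semiMap M j j) (Algebra.TensorProduct.assoc K K K R R R (map Δ (.id K R) u)) =
      TensorProduct.assoc M B B B ((Coalgebra.comul (R := M)).rTensor B (semiMap M j j u)) := by
  induction u with
  | zero => simp
  | add x y hx hy => simp only [map_add, hx, hy]
  | tmul x y => rw [map_tmul, AlgHom.id_apply, semiMap_assoc_tmul, hΔ, semiMap_tmul,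
      LinearMap.rTensor_tmul]

/-- The bialgebra structure on a form of a Hopf algebra. -/
@[reducible] def bialgebra : Bialgebra K R :=
  Bialgebra.ofAlgHom hj.exists_comul.choose hj.exists_counit.choose
    (by
      have hΔ := hj.exists_comul.choose_spec
      set Δ := hj.exists_comul.choose
      ext r
      -- Each Hopf axiom is checked after the injective map into a tensor power of `B`, where it is
      -- already known.
      apply (hj.indep.tmul (hj.indep.tmul hj.indep)).injective
      change semiMap M j (semiMap M j j) (Algebra.TensorProduct.assoc K K K R R R
        (map Δ (.id K R) (Δ r))) = semiMap M j (semiMap M j j) (map (.id K R) Δ (Δ r))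
      rw [semiMap_assoc_map_comul_id hΔ, semiMap_map_id_comul hΔ, hΔ, Coalgebra.coassoc_apply])
    (by
      have hΔ := hj.exists_comul.choose_spec
      have hε := hj.exists_counit.choose_spec
      set Δ := hj.exists_comul.choose
      set ε := hj.exists_counit.choose
      have key : ∀ u : R ⊗[K] R, j (Algebra.TensorProduct.lid K R (map ε (.id K R) u)) =
          TensorProduct.lid M B ((Coalgebra.counit (R := M)).rTensor B (semiMap M j j u)) := by
        intro u
        induction u with
        | zero => simp
        | add x y hx hy => simp only [map_add, hx, hy]
        | tmul x y => simp [← hε]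
      ext r
      apply (Algebra.TensorProduct.lid K R).injective
      apply hj.indep.injective
      change j (Algebra.TensorProduct.lid K R (map ε (.id K R) (Δ r))) =
        j (Algebra.TensorProduct.lid K R ((Algebra.TensorProduct.lid K R).symm r))
      rw [key, hΔ, Coalgebra.rTensor_counit_comul, AlgEquiv.apply_symm_apply]
      simp)
    (by
      have hΔ := hj.exists_comul.choose_spec
      have hε := hj.exists_counit.choose_spec
      set Δ := hj.exists_comul.choose
      set ε := hj.exists_counit.choose
      have key : ∀ u : R ⊗[K] R, j (Algebra.TensorProduct.rid K K R (map (.id K R) ε u)) =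
          TensorProduct.rid M B ((Coalgebra.counit (R := M)).lTensor B (semiMap M j j u)) := by
        intro u
        induction u with
        | zero => simp
        | add x y hx hy => simp only [map_add, hx, hy]
        | tmul x y => simp [← hε]
      ext r
      apply (Algebra.TensorProduct.rid K K R).injective
      apply hj.indep.injective
      change j (Algebra.TensorProduct.rid K K R (map (.id K R) ε (Δ r))) =
        j (Algebra.TensorProduct.rid K K R ((Algebra.TensorProduct.rid K K R).symm r))
      rw [key, hΔ, Coalgebra.lTensor_counit_comul, AlgEquiv.apply_symm_apply]
      simp)

theorem semiMap_comul (r : R) : letI := hj.bialgebra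
    semiMap M j j (Coalgebra.comul (R := K) r) = Coalgebra.comul (R := M) (j r) :=
  hj.exists_comul.choose_spec r

theorem algebraMap_counit (r : R) : letI := hj.bialgebra
    algebraMap K M (Coalgebra.counit (R := K) r) = Coalgebra.counit (R := M) (j r) :=
  hj.exists_counit.choose_spec r

/-- The Hopf algebra structure on a form of a Hopf algebra. -/
@[reducible] def hopfAlgebra : HopfAlgebra K R :=
  letI := hj.bialgebra
  HopfAlgebra.ofAlgHom hj.exists_antipode.choose
    (by
      have hS := hj.exists_antipode.choose_spec
      set S := hj.exists_antipode.choose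
      have key : ∀ u : R ⊗[K] R, j (lift S (.id K R) (fun _ _ => .all _ _) u) =
          LinearMap.mul' M B ((HopfAlgebra.antipode M).rTensor B (semiMap M j j u)) := by
        intro u
        induction u with
        | zero => simp
        | add x y hx hy => simp only [map_add, hx, hy]
        | tmul x y => simp [hS]
      ext r
      apply hj.indep.injective
      change j (lift S (.id K R) (fun _ _ => .all _ _) (Coalgebra.comul (R := K) r)) =
        j (algebraMap K R (Coalgebra.counit (R := K) r))
      rw [key, hj.semiMap_comul, HopfAlgebra.mul_antipode_rTensor_comul_apply, AlgHom.commutes,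
        ← hj.algebraMap_counit, ← IsScalarTower.algebraMap_apply])
    (by
      have hS := hj.exists_antipode.choose_spec
      set S := hj.exists_antipode.choose
      have key : ∀ u : R ⊗[K] R, j (lift (.id K R) S (fun _ _ => .all _ _) u) =
          LinearMap.mul' M B ((HopfAlgebra.antipode M).lTensor B (semiMap M j j u)) := by
        intro u
        induction u with
        | zero => simp
        | add x y hx hy => simp only [map_add, hx, hy]
        | tmul x y => simp [hS]
      ext r
      apply hj.indep.injective
      change j (lift (.id K R) S (fun _ _ => .all _ _) (Coalgebra.comul (R := K) r)) =
        j (algebraMap K R (Coalgebra.counit (R := K) r))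
      rw [key, hj.semiMap_comul, HopfAlgebra.mul_antipode_lTensor_comul_apply, AlgHom.commutes,
        ← hj.algebraMap_counit, ← IsScalarTower.algebraMap_apply])

theorem isCocomm [Coalgebra.IsCocomm M B] : letI := hj.hopfAlgebra
    Coalgebra.IsCocomm K R := by
  let := hj.hopfAlgebra
  refine ⟨?_⟩
  ext r
  apply (hj.indep.tmul hj.indep).injective
  have key : ∀ u : R ⊗[K] R, semiMap M j j (TensorProduct.comm K R R u) =
      TensorProduct.comm M B B (semiMap M j j u) := by
    intro u
    induction u with
    | zero => simp
    | add x y hx hy => simp only [map_add, hx, hy]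
    | tmul x y => simp
  change semiMap M j j (TensorProduct.comm K R R (Coalgebra.comul r)) = semiMap M j j _
  rw [key, hj.semiMap_comul, Coalgebra.comm_comul]

/-- Independence of the image of a basis gives injectivity, and the spanning condition gives
surjectivity. -/
theorem lift_bijective : Function.Bijective
    (lift (Algebra.ofId M B) j (fun _ _ => .all _ _) : M ⊗[K] R →ₐ[M] B) := by
  obtain ⟨ι, b, hb⟩ := hj.indep
  constructor
  · let c := Algebra.TensorProduct.basis M b
    have hc : LinearIndependent M fun i =>
        (lift (Algebra.ofId M B) j (fun _ _ => .all _ _) : M ⊗[K] R →ₐ[M] B) (c i) := by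
      simpa [c] using hb
    have h3 : (lift (Algebra.ofId M B) j (fun _ _ => .all _ _) : M ⊗[K] R →ₐ[M] B).toLinearMap ∘ₗ
        c.repr.symm.toLinearMap = Finsupp.linearCombination M (fun i =>
        (lift (Algebra.ofId M B) j (fun _ _ => .all _ _) : M ⊗[K] R →ₐ[M] B) (c i)) := by
      ext i; simp
    rw [injective_iff_map_eq_zero]
    intro a ha
    have h4 : c.repr a = 0 := by
      apply hc
      rw [← h3]
      simpa using ha
    simpa using h4
  · rw [← AlgHom.coe_toLinearMap, ← LinearMap.range_eq_top, eq_top_iff, ← hj.span,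
      Submodule.span_le]
    rintro _ ⟨r, rfl⟩
    exact ⟨1 ⊗ₜ r, by simp⟩

theorem nonempty_bialgEquiv : letI := hj.hopfAlgebra
    Nonempty ((M ⊗[K] R) ≃ₐc[M] B) := by
  let := hj.hopfAlgebra
  refine ⟨BialgEquiv.ofAlgEquiv (AlgEquiv.ofBijective _ hj.lift_bijective) ?_ ?_⟩
  · ext r
    simp [← hj.algebraMap_counit, Algebra.algebraMap_eq_smul_one]
  · ext r
    have key : ∀ u : R ⊗[K] R, map
        (lift (Algebra.ofId M B) j (fun _ _ => .all _ _) : M ⊗[K] R →ₐ[M] B)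
        (lift (Algebra.ofId M B) j (fun _ _ => .all _ _) : M ⊗[K] R →ₐ[M] B)
        (TensorProduct.AlgebraTensorModule.tensorTensorTensorComm K M K M M M R R
          ((1 ⊗ₜ 1) ⊗ₜ u)) = semiMap M j j u := by
      intro u
      induction u with
      | zero => simp
      | add x y hx hy => simp only [map_add, TensorProduct.tmul_add, hx, hy]
      | tmul x y => simp
    have h1 := key (Coalgebra.comul r)
    rw [hj.semiMap_comul] at h1
    simpa using h1

end IsHopfForm

end Descent

/-! ### The algebra of a regular abelian permutation group, as a form of `M[N]`. -/

section Construction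

variable {K : Type u} {L : Type v} {M : Type w} [Field K] [Field L] [Field M]
  [Algebra K L] [Algebra K M]

variable {N : Type*} [CommGroup N] (π : N →* Equiv.Perm (L →ₐ[K] M))

/-- An element `∑ c_η η` of the group algebra as the function `(x, l) ↦ ∑ c_η (η x)(l)`. -/
def permEval : MonoidAlgebra M N →ₗ[M] ((L →ₐ[K] M) → L → M) :=
  (MonoidAlgebra.basis N M).constr M fun η x l => π η x l

@[simp] theorem permEval_single (η : N) (a : M) (x : L →ₐ[K] M) (l : L) :
    permEval π (MonoidAlgebra.single η a) x l = a * π η x l := by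
  have h : MonoidAlgebra.single η a = a • MonoidAlgebra.basis N M η := by
    simp [MonoidAlgebra.basis_apply]
  rw [h, map_smul, permEval, Module.Basis.constr_basis]
  rfl

theorem permEval_add_arg (c : MonoidAlgebra M N) (x : L →ₐ[K] M) (l l' : L) :
    permEval π c x (l + l') = permEval π c x l + permEval π c x l' := by
  induction c using MonoidAlgebra.induction_linear with
  | zero => simp
  | add c d hc hd => simp only [map_add, Pi.add_apply, hc, hd]; ring
  | single η a => simp [mul_add]

theorem permEval_smul_arg (c : MonoidAlgebra M N) (x : L →ₐ[K] M) (k : K) (l : L) :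
    permEval π c x (k • l) = algebraMap K M k * permEval π c x l := by
  induction c using MonoidAlgebra.induction_linear with
  | zero => simp
  | add c d hc hd => simp only [map_add, Pi.add_apply, hc, hd]; ring
  | single η a => simp [Algebra.smul_def]; ring

theorem permEval_single_mul (η : N) (a : M) (d : MonoidAlgebra M N) (x : L →ₐ[K] M) (l : L) :
    permEval π (MonoidAlgebra.single η a * d) x l = a * permEval π d (π η x) l := by
  induction d using MonoidAlgebra.induction_linear with
  | zero => simp
  | add c d hc hd => simp only [mul_add, map_add, Pi.add_apply, hc, hd]
  | single θ b =>
    -- The identity has `η` acting on the embedding before `θ`, the reverse of the product in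
    -- `Perm`; commutativity of `N` reconciles the two.
    rw [MonoidAlgebra.single_mul_single, permEval_single, permEval_single, mul_comm η θ, map_mul,
      Equiv.Perm.mul_apply, mul_assoc]

theorem permEval_mul (c d : MonoidAlgebra M N) (T : Module.End K L)
    (hd : ∀ x l, permEval π d x l = x (T l)) (x : L →ₐ[K] M) (l : L) :
    permEval π (c * d) x l = permEval π c x (T l) := by
  induction c using MonoidAlgebra.induction_linear with
  | zero => simp
  | add c c' hc hc' => simp only [add_mul, map_add, Pi.add_apply, hc, hc']
  | single η a => rw [permEval_single_mul, hd, permEval_single]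

/-- The algebra of endomorphisms of `L` that act on embeddings through the group algebra `M[N]`. -/
def translationAlgebra : Subalgebra K (Module.End K L) where
  carrier := {T | ∃ c, ∀ x l, permEval π c x l = x (T l)}
  mul_mem' := by
    rintro T T' ⟨c, hc⟩ ⟨d, hd⟩
    exact ⟨c * d, fun x l => by rw [permEval_mul π c d T' hd, hc]; rfl⟩
  add_mem' := by
    rintro T T' ⟨c, hc⟩ ⟨d, hd⟩
    exact ⟨c + d, fun x l => by simp [hc, hd]⟩
  algebraMap_mem' k := ⟨MonoidAlgebra.single 1 (algebraMap K M k), fun x l => by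
    simp [Module.algebraMap_end_apply, Algebra.smul_def]⟩

instance [Nonempty (L →ₐ[K] M)] : CommRing (translationAlgebra π) :=
  { (inferInstance : Ring (translationAlgebra π)) with
    mul_comm := by
      rintro ⟨T, c, hc⟩ ⟨T', d, hd⟩
      ext l
      apply (Classical.arbitrary (L →ₐ[K] M)).injective
      change (Classical.arbitrary (L →ₐ[K] M)) (T (T' l)) =
        (Classical.arbitrary (L →ₐ[K] M)) (T' (T l))
      rw [← hc, ← hd, ← permEval_mul π c d T' hd, ← permEval_mul π d c T hc, mul_comm] }

variable (hreg : ∀ x y : L →ₐ[K] M, ∃! η, π η x = y)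
include hreg

theorem permEval_linearIndependent (x : L →ₐ[K] M) :
    LinearIndependent M (fun η : N => (fun l => π η x l : L → M)) :=
  algHom_linearIndependent.comp (fun η => π η x) fun _ θ h =>
    (hreg x (π θ x)).unique h rfl

/-- One embedding suffices: by regularity the `π η x` are distinct, hence independent by Dedekind.
-/
theorem permEval_apply_injective (x : L →ₐ[K] M) {c d : MonoidAlgebra M N}
    (h : ∀ l, permEval π c x l = permEval π d x l) : c = d := by
  have h1 : (LinearMap.proj x ∘ₗ permEval π) ∘ₗ (MonoidAlgebra.basis N M).repr.symm.toLinearMap =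
      Finsupp.linearCombination M (fun η : N => (fun l => π η x l : L → M)) := by
    ext η l
    simp [MonoidAlgebra.basis_apply]
  have h2 : Function.Injective (LinearMap.proj x ∘ₗ permEval π) := by
    have h3 : Function.Injective ((LinearMap.proj x ∘ₗ permEval π) ∘ₗ
        (MonoidAlgebra.basis N M).repr.symm.toLinearMap) := by
      rw [h1]; exact permEval_linearIndependent π hreg x
    intro a b hab
    apply (MonoidAlgebra.basis N M).repr.injective
    apply h3
    simpa using hab
  exact h2 (funext h)

variable [Nonempty (L →ₐ[K] M)]

/-- The embedding of the translation algebra into the group algebra. -/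
def toGroupAlgebra : translationAlgebra π →ₐ[K] MonoidAlgebra M N where
  toFun T := T.2.choose
  map_one' := permEval_apply_injective π hreg (Classical.arbitrary _) fun l => by
    rw [Exists.choose_spec (Subtype.property (1 : translationAlgebra π)), MonoidAlgebra.one_def]
    simp
  map_zero' := permEval_apply_injective π hreg (Classical.arbitrary _) fun l => by
    rw [Exists.choose_spec (Subtype.property (0 : translationAlgebra π))]
    simp
  map_add' T T' := permEval_apply_injective π hreg (Classical.arbitrary _) fun l => by
    rw [Exists.choose_spec (Subtype.property (T + T')), map_add, Pi.add_apply, Pi.add_apply,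
      T.2.choose_spec, T'.2.choose_spec]
    simp
  map_mul' T T' := permEval_apply_injective π hreg (Classical.arbitrary _) fun l => by
    rw [Exists.choose_spec (Subtype.property (T * T')),
      permEval_mul π _ _ T' T'.2.choose_spec, T.2.choose_spec]
    rfl
  commutes' k := permEval_apply_injective π hreg (Classical.arbitrary _) fun l => by
    rw [Exists.choose_spec (Subtype.property (algebraMap K (translationAlgebra π) k)),
      MonoidAlgebra.coe_algebraMap]
    simp [Module.algebraMap_end_apply, Algebra.smul_def]

theorem permEval_toGroupAlgebra (T : translationAlgebra π) (x : L →ₐ[K] M) (l : L) :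
    permEval π (toGroupAlgebra π hreg T) x l = x ((T : Module.End K L) l) :=
  T.2.choose_spec x l

theorem toGroupAlgebra_eq_iff (T : translationAlgebra π) (c : MonoidAlgebra M N) :
    toGroupAlgebra π hreg T = c ↔ ∀ x l, permEval π c x l = x ((T : Module.End K L) l) := by
  refine ⟨?_, fun h => ?_⟩
  · rintro rfl
    exact permEval_toGroupAlgebra π hreg T
  · refine permEval_apply_injective π hreg (Classical.arbitrary _) fun l => ?_
    rw [h, permEval_toGroupAlgebra]

/-- Galois-invariant elements descend: for fixed `l`, the equivariant function of `x` is evaluation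
at some `t l ∈ L`, and `t` is the required endomorphism. -/
theorem mem_range_toGroupAlgebra [FiniteDimensional K L] [FiniteDimensional K M] [IsGalois K M]
    [IsNormalClosure K L M] (c : MonoidAlgebra M N)
    (hc : ∀ σ x l, permEval π c (galPerm K L M σ x) l = σ (permEval π c x l)) :
    c ∈ (toGroupAlgebra π hreg).range := by
  choose t ht using fun l => exists_eval_of_equivariant (K := K) (L := L) (M := M)
    (fun x => permEval π c x l) (fun σ x => hc σ x l)
  obtain ⟨x₀⟩ := ‹Nonempty (L →ₐ[K] M)›
  let T : Module.End K L :=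
    { toFun := t
      map_add' := fun l l' => x₀.toRingHom.injective (by
        change x₀ _ = x₀ _
        rw [map_add, ← ht, ← ht, ← ht, permEval_add_arg])
      map_smul' := fun k l => x₀.toRingHom.injective (by
        change x₀ _ = x₀ (k • t l)
        rw [map_smul, ← ht, ← ht, permEval_smul_arg, Algebra.smul_def]) }
  exact ⟨⟨T, c, fun x l => ht l x⟩, (toGroupAlgebra_eq_iff π hreg _ _).2 fun x l => ht l x⟩

theorem permEval_equivariant (T : translationAlgebra π) (σ : Gal(M/K)) (x : L →ₐ[K] M) (l : L) :
    permEval π (toGroupAlgebra π hreg T) (galPerm K L M σ x) l =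
      σ (permEval π (toGroupAlgebra π hreg T) x l) := by
  rw [permEval_toGroupAlgebra, permEval_toGroupAlgebra, galPerm_apply]

theorem permHom_injective : Function.Injective π := by
  intro η θ h
  exact (hreg (Classical.arbitrary _) (π θ (Classical.arbitrary _))).unique (by rw [h]) rfl

/-- Conjugation by the Galois group on a normalised regular permutation group. -/
theorem exists_conjugation
    (hnorm : ∀ (σ : Gal(M/K)) (η : N), ∃ θ, π θ = galPerm K L M σ * π η * (galPerm K L M σ)⁻¹)
    (σ : Gal(M/K)) : ∃ α : N ≃ N,
      ∀ η, π (α η) = galPerm K L M σ * π η * (galPerm K L M σ)⁻¹ := by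
  choose f hf using hnorm
  have hπ := permHom_injective π hreg
  refine ⟨⟨f σ, f σ⁻¹, fun η => hπ ?_, fun η => hπ ?_⟩, hf σ⟩ <;>
  · rw [hf, hf, map_inv]; group

/-- Let a functional `φ` vanish on the invariants. The averages `∑ σ(b) · (σ η σ⁻¹)` are invariant
for every `b ∈ M`, so Dedekind independence of the automorphisms makes each `φ(σ η σ⁻¹)` zero; `σ =
1` gives `φ = 0`. -/
theorem span_range_toGroupAlgebra [FiniteDimensional K L] [FiniteDimensional K M] [IsGalois K M]
    [IsNormalClosure K L M]
    (hnorm : ∀ (σ : Gal(M/K)) (η : N), ∃ θ, π θ = galPerm K L M σ * π η * (galPerm K L M σ)⁻¹) :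
    Submodule.span M (Set.range (toGroupAlgebra π hreg)) = ⊤ := by
  by_contra hne
  obtain ⟨φ, hφ, hker⟩ := Submodule.exists_le_ker_of_lt_top _ (lt_top_iff_ne_top.2 hne)
  apply hφ
  choose α hα using exists_conjugation π hreg hnorm
  refine (MonoidAlgebra.basis N M).ext fun η => ?_
  have key : ∀ b : M, ∑ σ : Gal(M/K), σ b * φ (MonoidAlgebra.single (α σ η) 1) = 0 := by
    intro b
    have hmem : (∑ σ : Gal(M/K), MonoidAlgebra.single (α σ η) (σ b)) ∈
        (toGroupAlgebra π hreg).range := by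
      apply mem_range_toGroupAlgebra
      intro τ x l
      simp only [map_sum, Finset.sum_apply, permEval_single, hα, Equiv.Perm.mul_apply,
        galPerm_apply, map_mul]
      rw [← Equiv.sum_comp (Equiv.mulLeft τ)]
      refine Finset.sum_congr rfl fun σ _ => ?_
      have h2 : (galPerm K L M (τ * σ))⁻¹ (galPerm K L M τ x) = (galPerm K L M σ)⁻¹ x := by
        rw [map_mul, mul_inv_rev, Equiv.Perm.mul_apply]
        exact congrArg _ ((galPerm K L M τ).symm_apply_apply x)
      rw [Equiv.coe_mulLeft, h2]
      rfl
    obtain ⟨T, hT⟩ := hmem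
    have h0 : φ (∑ σ : Gal(M/K), MonoidAlgebra.single (α σ η) (σ b)) = 0 :=
      hker (Submodule.subset_span ⟨T, hT⟩)
    rw [map_sum] at h0
    rw [← h0]
    refine Finset.sum_congr rfl fun σ _ => ?_
    rw [← smul_eq_mul, ← map_smul, MonoidAlgebra.smul_single, smul_eq_mul, mul_one]
  have h1 := algEquiv_eq_zero_of_sum (fun σ : Gal(M/K) => σ) Function.injective_id _ key 1
  have h2 : α 1 η = η := permHom_injective π hreg (by rw [hα]; simp)
  rw [h2] at h1
  simpa [MonoidAlgebra.basis_apply] using h1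

theorem toGroupAlgebra_comp_basis [FiniteDimensional K M] [IsGalois K M]
    {ι : Type*} (b : Module.Basis ι K (translationAlgebra π)) :
    LinearIndependent M fun i => toGroupAlgebra π hreg (b i) := by
  have h := evalMap_linearIndependent (M := M) (fun i l => (b i : Module.End K L) l) (by
    have h2 := b.linearIndependent.map' (translationAlgebra π).val.toLinearMap
      (LinearMap.ker_eq_bot.2 Subtype.val_injective)
    let φ : Module.End K L →ₗ[K] (L → L) :=
      { toFun := fun T => T, map_add' := fun _ _ => rfl, map_smul' := fun _ _ => rfl }
    exact h2.map' φ (LinearMap.ker_eq_bot.2 DFunLike.coe_injective))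
  refine LinearIndependent.of_comp (permEval π) ?_
  convert h using 1
  ext i x l
  exact permEval_toGroupAlgebra π hreg _ x l

theorem isIndep_toGroupAlgebra [FiniteDimensional K L] [FiniteDimensional K M] [IsGalois K M] :
    IsIndep M (toGroupAlgebra π hreg) :=
  ⟨_, Module.finBasis K (translationAlgebra π), toGroupAlgebra_comp_basis π hreg _⟩

end Construction

/-! ### The Hopf Galois structure of a normalised regular abelian group. -/

section HopfForm

variable {K : Type u} {L : Type v} {M : Type w} [Field K] [Field L] [Field M]
  [Algebra K L] [Algebra K M]

variable {N : Type*} [CommGroup N] (π : N →* Equiv.Perm (L →ₐ[K] M))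

/-- Two elements of the group algebra acting on a pair of elements of `L`. -/
def pairEval : MonoidAlgebra M N ⊗[M] MonoidAlgebra M N →ₗ[M] ((L →ₐ[K] M) → L × L → M) :=
  LinearMap.pi fun x => LinearMap.pi fun l => LinearMap.mul' M M ∘ₗ
    TensorProduct.map (LinearMap.proj l.1 ∘ₗ LinearMap.proj x ∘ₗ permEval π)
      (LinearMap.proj l.2 ∘ₗ LinearMap.proj x ∘ₗ permEval π)

@[simp] theorem pairEval_tmul (c d : MonoidAlgebra M N) (x : L →ₐ[K] M) (l : L × L) :
    pairEval π (c ⊗ₜ d) x l = permEval π c x l.1 * permEval π d x l.2 := rfl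

theorem pairEval_comul (c : MonoidAlgebra M N) (x : L →ₐ[K] M) (l : L × L) :
    pairEval π (Coalgebra.comul (R := M) c) x l = permEval π c x (l.1 * l.2) := by
  induction c using MonoidAlgebra.induction_linear with
  | zero => simp
  | add c d hc hd => simp only [map_add, Pi.add_apply, hc, hd]
  | single η a => simp [MonoidAlgebra.comul_single]; ring

variable (hreg : ∀ x y : L →ₐ[K] M, ∃! η, π η x = y)
include hreg

theorem pairEval_apply_injective (x : L →ₐ[K] M)
    {u v : MonoidAlgebra M N ⊗[M] MonoidAlgebra M N}
    (h : ∀ l, pairEval π u x l = pairEval π v x l) : u = v := by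
  let b := (MonoidAlgebra.basis N M).tensorProduct (MonoidAlgebra.basis N M)
  have h0 : LinearIndependent M (fun i : N × N => (fun l => π i.1 x l.1 * π i.2 x l.2 :
      L × L → M)) := by
    let f : N × N → (L × L →* M) := fun i =>
      { toFun := fun l => π i.1 x l.1 * π i.2 x l.2
        map_one' := by simp
        map_mul' := fun l l' => by simp only [Prod.fst_mul, Prod.snd_mul, map_mul]; ring }
    -- Dedekind for the monoid `L × L`; the two embeddings are recovered on `(l, 1)` and `(1, l)`.
    refine (linearIndependent_monoidHom (L × L) M).comp f ?_
    rintro ⟨i, j⟩ ⟨i', j'⟩ h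
    have hi : π i x = π i' x := by
      ext l
      simpa [f] using DFunLike.congr_fun h (l, 1)
    have hj : π j x = π j' x := by
      ext l
      simpa [f] using DFunLike.congr_fun h (1, l)
    rw [(hreg x _).unique hi rfl, (hreg x _).unique hj rfl]
  have h1 : (LinearMap.proj x ∘ₗ pairEval π) ∘ₗ b.repr.symm.toLinearMap =
      Finsupp.linearCombination M (fun i : N × N => (fun l => π i.1 x l.1 * π i.2 x l.2 :
      L × L → M)) := by
    ext i l
    simp [b, Module.Basis.tensorProduct_apply', MonoidAlgebra.basis_apply]
  have h3 : Function.Injective ((LinearMap.proj x ∘ₗ pairEval π) ∘ₗ b.repr.symm.toLinearMap) := by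
    rw [h1]; exact h0
  apply b.repr.injective
  apply h3
  simpa using funext h

variable [Nonempty (L →ₐ[K] M)]

/-- The action of `u ∈ H ⊗ H` on pairs of elements of `L`. -/
def pairAction {K : Type*} {L : Type*} [Field K] [Field L] [Algebra K L] {H : Type*}
    [AddCommGroup H] [Module K H] (a : H →ₗ[K] Module.End K L) :
    H ⊗[K] H →ₗ[K] (L × L → L) :=
  LinearMap.pi fun l => LinearMap.mul' K L ∘ₗ TensorProduct.map (a.flip l.1) (a.flip l.2)

theorem evalMap_pairAction (u : translationAlgebra π ⊗[K] translationAlgebra π)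
    (x : L →ₐ[K] M) (l : L × L) :
    x (pairAction (translationAlgebra π).val.toLinearMap u l) =
      pairEval π (semiMap M (toGroupAlgebra π hreg) (toGroupAlgebra π hreg) u) x l := by
  induction u with
  | zero => simp
  | add u v hu hv => simp only [map_add, Pi.add_apply, hu, hv]
  | tmul T T' =>
    rw [semiMap_tmul, pairEval_tmul, permEval_toGroupAlgebra, permEval_toGroupAlgebra, ← map_mul]
    rfl

variable [FiniteDimensional K L] [FiniteDimensional K M] [IsGalois K M] [IsNormalClosure K L M]
  (hnorm : ∀ (σ : Gal(M/K)) (η : N), ∃ θ, π θ = galPerm K L M σ * π η * (galPerm K L M σ)⁻¹)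
include hnorm

theorem span_semiMap_toGroupAlgebra : Submodule.span M (Set.range
    (semiMap M (toGroupAlgebra π hreg) (toGroupAlgebra π hreg))) = ⊤ := by
  have hs := span_range_toGroupAlgebra π hreg hnorm
  rw [eq_top_iff, ← TensorProduct.span_tmul_eq_top, Submodule.span_le]
  rintro _ ⟨c, d, rfl⟩
  have hc : c ∈ Submodule.span M (Set.range (toGroupAlgebra π hreg)) := hs ▸ Submodule.mem_top
  have hd : d ∈ Submodule.span M (Set.range (toGroupAlgebra π hreg)) := hs ▸ Submodule.mem_top
  rw [SetLike.mem_coe]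
  induction hc using Submodule.span_induction with
  | zero => simp
  | add a b _ _ ha hb => rw [TensorProduct.add_tmul]; exact add_mem ha hb
  | smul m a _ ha => rw [← TensorProduct.smul_tmul']; exact Submodule.smul_mem _ _ ha
  | mem a ha =>
    obtain ⟨T, rfl⟩ := ha
    induction hd using Submodule.span_induction with
    | zero => simp
    | add a b _ _ ha hb => rw [TensorProduct.tmul_add]; exact add_mem ha hb
    | smul m a _ ha => rw [TensorProduct.tmul_smul]; exact Submodule.smul_mem _ _ ha
    | mem a ha =>
      obtain ⟨T', rfl⟩ := ha
      exact Submodule.subset_span ⟨T ⊗ₜ T', semiMap_tmul _ _ _ _⟩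

/-- Since `M`-combinations of `H ⊗ H` fill `M[N] ⊗ M[N]`, the function `(l, l') ↦ T (l l')` lies in
the `M`-span of the functions given by `H ⊗ H`. It is defined over `K`, so by descent it already
comes from `H ⊗ H`. -/
theorem comul_toGroupAlgebra_mem (T : translationAlgebra π) :
    Coalgebra.comul (R := M) (toGroupAlgebra π hreg T) ∈
      (semiMap M (toGroupAlgebra π hreg) (toGroupAlgebra π hreg)).range := by
  have h := mem_of_evalMap_mem_span (M := M)
    (LinearMap.range (pairAction (translationAlgebra π).val.toLinearMap))
    (fun l => (T : Module.End K L) (l.1 * l.2)) (by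
      have h1 : evalMap K L M (L × L) (fun l => (T : Module.End K L) (l.1 * l.2)) =
          pairEval π (Coalgebra.comul (R := M) (toGroupAlgebra π hreg T)) := by
        ext x l
        rw [pairEval_comul, permEval_toGroupAlgebra, evalMap_apply]
      rw [h1]
      have h2 : Coalgebra.comul (R := M) (toGroupAlgebra π hreg T) ∈ Submodule.span M (Set.range
          (semiMap M (toGroupAlgebra π hreg) (toGroupAlgebra π hreg))) :=
        span_semiMap_toGroupAlgebra π hreg hnorm ▸ Submodule.mem_top
      have h3 := Submodule.mem_map_of_mem (f := pairEval π) h2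
      rw [Submodule.map_span, ← Set.range_comp] at h3
      refine Submodule.span_mono ?_ h3
      rintro _ ⟨u, rfl⟩
      refine ⟨_, ⟨u, rfl⟩, ?_⟩
      ext x l
      exact evalMap_pairAction π hreg u x l)
  obtain ⟨u, hu⟩ := h
  refine ⟨u, pairEval_apply_injective π hreg (Classical.arbitrary _) fun l => ?_⟩
  rw [pairEval_comul, permEval_toGroupAlgebra]
  have h4 := evalMap_pairAction π hreg u (Classical.arbitrary _) l
  rw [hu] at h4
  exact h4.symm

omit hnorm [FiniteDimensional K L] [FiniteDimensional K M] [IsGalois K M] [IsNormalClosure K L M]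
  [Nonempty (L →ₐ[K] M)] hreg in
theorem counit_eq_permEval_one (c : MonoidAlgebra M N) (x : L →ₐ[K] M) :
    Coalgebra.counit (R := M) c = permEval π c x 1 := by
  induction c using MonoidAlgebra.induction_linear with
  | zero => simp
  | add c d hc hd => simp only [map_add, Pi.add_apply, hc, hd]
  | single η a => simp

omit hnorm [FiniteDimensional K L] [IsNormalClosure K L M] in
theorem counit_toGroupAlgebra_mem (T : translationAlgebra π) :
    Coalgebra.counit (R := M) (toGroupAlgebra π hreg T) ∈ (Algebra.ofId K M).range := by
  rw [counit_eq_permEval_one π _ (Classical.arbitrary _)]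
  refine (IsGalois.mem_range_algebraMap_iff_fixed _).2 fun σ => ?_
  rw [← permEval_equivariant, ← counit_eq_permEval_one, ← counit_eq_permEval_one]

theorem antipode_toGroupAlgebra_mem (T : translationAlgebra π) :
    HopfAlgebra.antipode M (toGroupAlgebra π hreg T) ∈ (toGroupAlgebra π hreg).range := by
  have hπ := permHom_injective π hreg
  apply mem_range_toGroupAlgebra
  intro σ x l
  obtain ⟨α, hα⟩ := exists_conjugation π hreg hnorm σ
  -- `s` is the semilinear action of `σ` on `M[N]`, by `σ` on coefficients and by conjugation on
  -- `N`. It fixes the image of `T` and commutes with the antipode.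
  let s : MonoidAlgebra M N →+ MonoidAlgebra M N :=
    (MonoidAlgebra.mapDomainLinearMap M M α).toAddMonoidHom.comp
      (MonoidAlgebra.mapRingHom N (σ : M →+* M)).toAddMonoidHom
  have hs : ∀ η a, s (MonoidAlgebra.single η a) = MonoidAlgebra.single (α η) (σ a) := by
    intro η a
    simp [s]
  have hperm : ∀ c x l, permEval π (s c) (galPerm K L M σ x) l = σ (permEval π c x l) := by
    intro c x l
    induction c using MonoidAlgebra.induction_linear with
    | zero => simp
    | add c d hc hd => simp only [map_add, Pi.add_apply, hc, hd]
    | single η a => simp [hs, hα]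
  have hfix : s (toGroupAlgebra π hreg T) = toGroupAlgebra π hreg T := by
    refine permEval_apply_injective π hreg (galPerm K L M σ x) fun l => ?_
    rw [hperm, permEval_equivariant]
  have hanti : ∀ c, s (HopfAlgebra.antipode M c) = HopfAlgebra.antipode M (s c) := by
    intro c
    induction c using MonoidAlgebra.induction_linear with
    | zero => simp
    | add c d hc hd => simp only [map_add, hc, hd]
    | single η a =>
      have h : α η⁻¹ = (α η)⁻¹ := hπ (by rw [hα, map_inv, map_inv, hα]; group)
      simp [hs, h]
  rw [← hperm, hanti, hfix]

theorem isHopfForm_toGroupAlgebra : IsHopfForm M (toGroupAlgebra π hreg) where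
  indep := isIndep_toGroupAlgebra π hreg
  span := span_range_toGroupAlgebra π hreg hnorm
  comul_mem := comul_toGroupAlgebra_mem π hreg hnorm
  counit_mem := counit_toGroupAlgebra_mem π hreg
  antipode_mem := antipode_toGroupAlgebra_mem π hreg hnorm

theorem finrank_translationAlgebra [Algebra.IsSeparable K L] :
    Module.finrank K (translationAlgebra π) = Module.finrank K L := by
  have e : N ≃ (L →ₐ[K] M) := Equiv.ofBijective (fun η => π η (Classical.arbitrary _))
    (Function.bijective_iff_existsUnique _ |>.2 fun y => hreg _ y)
  have : Finite N := Finite.of_equiv _ e.symm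
  have : Fintype N := Fintype.ofFinite N
  have h := (AlgEquiv.ofBijective _
    (isHopfForm_toGroupAlgebra π hreg hnorm).lift_bijective).toLinearEquiv.finrank_eq
  rw [Module.finrank_baseChange, Module.finrank_eq_card_basis (MonoidAlgebra.basis N M),
    ← Nat.card_eq_fintype_card, Nat.card_congr e, card_embeddings] at h
  exact h

theorem translationAlgebra_bijective [Algebra.IsSeparable K L] : Function.Bijective
    (TensorProduct.lift (((LinearMap.mul K (Module.End K L)).comp
      (Algebra.lmul K L).toLinearMap).compl₂ (translationAlgebra π).val.toLinearMap) :
        L ⊗[K] translationAlgebra π →ₗ[K] Module.End K L) := by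
  have hinj : Function.Injective (TensorProduct.lift (((LinearMap.mul K (Module.End K L)).comp
      (Algebra.lmul K L).toLinearMap).compl₂ (translationAlgebra π).val.toLinearMap) :
        L ⊗[K] translationAlgebra π →ₗ[K] Module.End K L) := by
    rw [injective_iff_map_eq_zero]
    intro u hu
    let b := Module.finBasis K (translationAlgebra π)
    let c := Algebra.TensorProduct.basis L b
    have hb := toGroupAlgebra_comp_basis π hreg b
    obtain ⟨x⟩ := ‹Nonempty (L →ₐ[K] M)›
    have h1 : ∑ i, x (c.repr u i) • toGroupAlgebra π hreg (b i) = 0 := by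
      refine permEval_apply_injective π hreg x fun l => ?_
      have h2 := LinearMap.congr_fun hu l
      rw [← c.sum_repr u, map_sum, LinearMap.sum_apply] at h2
      have h3 := congrArg x h2
      rw [map_sum, LinearMap.zero_apply, map_zero] at h3
      rw [map_sum, Finset.sum_apply, Finset.sum_apply, map_zero, Pi.zero_apply, Pi.zero_apply, ← h3]
      refine Finset.sum_congr rfl fun i _ => ?_
      rw [map_smul, Pi.smul_apply, Pi.smul_apply, permEval_toGroupAlgebra, smul_eq_mul, ← map_mul,
        Algebra.TensorProduct.basis_apply, TensorProduct.smul_tmul', smul_eq_mul, mul_one]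
      rfl
    rw [← c.sum_repr u]
    refine Finset.sum_eq_zero fun i _ => ?_
    have := Fintype.linearIndependent_iff.1 hb _ h1 i
    rw [map_eq_zero] at this
    rw [this, zero_smul]
  refine ⟨hinj, ?_⟩
  -- Both sides have `K`-dimension `[L : K]²`.
  rw [← LinearMap.injective_iff_surjective_of_finrank_eq_finrank]
  · exact hinj
  · rw [Module.finrank_tensorProduct, finrank_translationAlgebra π hreg hnorm,
      Module.finrank_linearMap]

/-- The Hopf Galois structure attached to a regular permutation group normalised by the
Galois group. -/
def hopfGaloisOfRegular [Algebra.IsSeparable K L] : HopfGaloisStructure K L :=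
  have hform := isHopfForm_toGroupAlgebra π hreg hnorm
  letI := hform.hopfAlgebra
  { H := translationAlgebra π
    hopf := (isHopfForm_toGroupAlgebra π hreg hnorm).hopfAlgebra
    cocomm := hform.isCocomm
    finite := inferInstance
    action := (translationAlgebra π).val
    action_one := fun T => by
      apply (Classical.arbitrary (L →ₐ[K] M)).injective
      change (Classical.arbitrary (L →ₐ[K] M)) _ = (Classical.arbitrary (L →ₐ[K] M)) _
      rw [AlgHom.commutes, hform.algebraMap_counit,
        counit_eq_permEval_one π _ (Classical.arbitrary _), permEval_toGroupAlgebra]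
      rfl
    action_mul := fun T l l' => by
      apply (Classical.arbitrary (L →ₐ[K] M)).injective
      have h := evalMap_pairAction π hreg (Coalgebra.comul (R := K) T)
        (Classical.arbitrary (L →ₐ[K] M)) (l, l')
      rw [hform.semiMap_comul, pairEval_comul, permEval_toGroupAlgebra] at h
      exact h.symm
    bijective := translationAlgebra_bijective π hreg hnorm }

theorem hopfGaloisOfRegular_hasType [Algebra.IsSeparable K L] :
    (hopfGaloisOfRegular π hreg hnorm).HasType M N :=
  (isHopfForm_toGroupAlgebra π hreg hnorm).nonempty_bialgEquiv

theorem range_hopfGaloisOfRegular [Algebra.IsSeparable K L] :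
    Set.range (hopfGaloisOfRegular π hreg hnorm).action = translationAlgebra π :=
  Subtype.range_coe

end HopfForm

/-! ### Every structure of abelian type comes from a regular group. -/

section Classification

variable {K : Type u} {L : Type v} {M : Type w} [Field K] [Field L] [Field M]
  [Algebra K L] [Algebra K M]

/-- At one point `x₀` the element `c` agrees with a single group element; values at `x₀` determine
`c`, so they agree everywhere. -/
theorem exists_perm_eq_of_permEval {N : Type*} [CommGroup N] [Nonempty (L →ₐ[K] M)]
    (π : N →* Equiv.Perm (L →ₐ[K] M)) (hreg : ∀ x y : L →ₐ[K] M, ∃! η, π η x = y)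
    (c : MonoidAlgebra M N) (f : (L →ₐ[K] M) → (L →ₐ[K] M))
    (h : ∀ x l, permEval π c x l = f x l) : ∃ θ, ∀ x, π θ x = f x := by
  obtain ⟨x₀⟩ := ‹Nonempty (L →ₐ[K] M)›
  obtain ⟨θ, hθ, -⟩ := hreg x₀ (f x₀)
  have hc : c = MonoidAlgebra.single θ 1 :=
    permEval_apply_injective π hreg x₀ fun l => by rw [h, permEval_single, one_mul, ← hθ]
  refine ⟨θ, fun x => ?_⟩
  ext l
  rw [← h, hc, permEval_single, one_mul]

theorem translationAlgebra_le_of_range_le {N N' : Type*} [CommGroup N] [CommGroup N']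
    (π : N →* Equiv.Perm (L →ₐ[K] M)) (π' : N' →* Equiv.Perm (L →ₐ[K] M))
    (hle : π.range ≤ π'.range) : translationAlgebra π ≤ translationAlgebra π' := by
  have h1 : ∀ c, ∃ d, permEval π' d = permEval π c := by
    intro c
    induction c using MonoidAlgebra.induction_linear with
    | zero => exact ⟨0, by simp⟩
    | add a b ha hb =>
      obtain ⟨d, hd⟩ := ha
      obtain ⟨d', hd'⟩ := hb
      exact ⟨d + d', by rw [map_add, map_add, hd, hd']⟩
    | single η a =>
      obtain ⟨θ, hθ⟩ := hle ⟨η, rfl⟩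
      exact ⟨MonoidAlgebra.single θ a, by ext x l; rw [permEval_single, permEval_single, hθ]⟩
  rintro T ⟨c, hc⟩
  obtain ⟨d, hd⟩ := h1 c
  exact ⟨d, fun x l => by rw [hd, hc]⟩

/-- The algebra remembers its group: it spans `M[N]` over `M`, and an element of `M[N']` acting as a
permutation of embeddings belongs to `N'`. -/
theorem range_le_of_translationAlgebra_le [Nonempty (L →ₐ[K] M)] {N N' : Type*} [CommGroup N]
    [CommGroup N'] [FiniteDimensional K L] [FiniteDimensional K M] [IsGalois K M]
    [IsNormalClosure K L M]
    (π : N →* Equiv.Perm (L →ₐ[K] M)) (hreg : ∀ x y : L →ₐ[K] M, ∃! η, π η x = y)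
    (hnorm : ∀ (σ : Gal(M/K)) (η : N), ∃ θ, π θ = galPerm K L M σ * π η * (galPerm K L M σ)⁻¹)
    (π' : N' →* Equiv.Perm (L →ₐ[K] M)) (hreg' : ∀ x y : L →ₐ[K] M, ∃! η, π' η x = y)
    (hle : translationAlgebra π ≤ translationAlgebra π') : π.range ≤ π'.range := by
  rintro _ ⟨η, rfl⟩
  have h1 : ∀ c ∈ Submodule.span M (Set.range (toGroupAlgebra π hreg)),
      permEval π c ∈ LinearMap.range (permEval π') := by
    intro c hc
    induction hc using Submodule.span_induction with
    | zero => simp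
    | add a b _ _ ha hb => rw [map_add]; exact add_mem ha hb
    | smul m a _ ha => rw [map_smul]; exact Submodule.smul_mem _ _ ha
    | mem c hc =>
      obtain ⟨T, rfl⟩ := hc
      obtain ⟨d, hd⟩ := hle T.2
      refine ⟨d, ?_⟩
      ext x l
      rw [hd, permEval_toGroupAlgebra]
  rw [span_range_toGroupAlgebra π hreg hnorm] at h1
  obtain ⟨c, hc⟩ := h1 (MonoidAlgebra.single η 1) Submodule.mem_top
  obtain ⟨θ, hθ⟩ := exists_perm_eq_of_permEval π' hreg' c (π η) fun x l => by
    rw [hc, permEval_single, one_mul]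
  exact ⟨θ, Equiv.ext hθ⟩

namespace HopfGaloisStructure

/-- The base change of a Hopf Galois structure, acting on functions on embeddings. -/
def baseEval (M : Type w) [Field M] [Algebra K M] (S : HopfGaloisStructure K L) :
    M ⊗[K] S.H →ₗ[M] ((L →ₐ[K] M) → L → M) :=
  LinearMap.liftBaseChange M
    { toFun := fun h => evalMap K L M L (S.action h)
      map_add' := fun h h' => by ext; simp
      map_smul' := fun k h => by ext; simp }

variable (S : HopfGaloisStructure K L)

@[simp] theorem baseEval_tmul (m : M) (h : S.H) (x : L →ₐ[K] M) (l : L) :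
    S.baseEval M (m ⊗ₜ h) x l = m * x (S.action h l) := by
  simp [baseEval]

theorem baseEval_mul_tmul (u : M ⊗[K] S.H) (m : M) (h : S.H) (x : L →ₐ[K] M) (l : L) :
    S.baseEval M (u * m ⊗ₜ h) x l = m * S.baseEval M u x (S.action h l) := by
  induction u with
  | zero => simp
  | add u v hu hv => simp only [add_mul, map_add, Pi.add_apply, hu, hv, mul_add]
  | tmul n k => simp; ring

theorem baseEval_mul (u v : M ⊗[K] S.H) (f : (L →ₐ[K] M) → (L →ₐ[K] M))
    (hu : ∀ x l, S.baseEval M u x l = f x l) (x : L →ₐ[K] M) (l : L) :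
    S.baseEval M (u * v) x l = S.baseEval M v (f x) l := by
  induction v with
  | zero => simp
  | add v w hv hw => simp only [mul_add, map_add, Pi.add_apply, hv, hw]
  | tmul m h => rw [baseEval_mul_tmul, hu, baseEval_tmul]

theorem baseEval_one_arg (u : M ⊗[K] S.H) (x : L →ₐ[K] M) :
    S.baseEval M u x 1 = Coalgebra.counit (R := M) u := by
  induction u with
  | zero => simp
  | add u v hu hv => simp only [map_add, Pi.add_apply, hu, hv]
  | tmul m h => simp [S.action_one, Algebra.smul_def, mul_comm]

theorem baseEval_mul_arg (u : M ⊗[K] S.H) (x : L →ₐ[K] M) (l l' : L) :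
    S.baseEval M u x (l * l') = LinearMap.mul' M M (TensorProduct.map
      (LinearMap.proj l ∘ₗ LinearMap.proj x ∘ₗ S.baseEval M)
      (LinearMap.proj l' ∘ₗ LinearMap.proj x ∘ₗ S.baseEval M) (Coalgebra.comul (R := M) u)) := by
  induction u with
  | zero => simp
  | add u v hu hv => simp only [map_add, Pi.add_apply, hu, hv]
  | tmul m h =>
    rw [baseEval_tmul, S.action_mul, TensorProduct.comul_tmul]
    have key : ∀ w : S.H ⊗[K] S.H, m * x (LinearMap.mul' K L
        (TensorProduct.map (S.action.toLinearMap.flip l) (S.action.toLinearMap.flip l') w)) =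
        LinearMap.mul' M M (TensorProduct.map
          (LinearMap.proj l ∘ₗ LinearMap.proj x ∘ₗ S.baseEval M)
          (LinearMap.proj l' ∘ₗ LinearMap.proj x ∘ₗ S.baseEval M)
          (TensorProduct.AlgebraTensorModule.tensorTensorTensorComm K M K M M M S.H S.H
            (Coalgebra.comul (R := M) m ⊗ₜ w))) := by
      intro w
      induction w with
      | zero => simp
      | add w w' hw hw' => simp only [map_add, TensorProduct.tmul_add, mul_add, hw, hw']
      | tmul a b => simp; ring
    exact key _

/-- The module algebra axioms turn `ε(g) = 1` and `Δ g = g ⊗ g` into unitality and multiplicativity.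
-/
theorem exists_algHom_of_groupLike {g : M ⊗[K] S.H} (hg : IsGroupLikeElem M g)
    (x : L →ₐ[K] M) : ∃ y : L →ₐ[K] M, ∀ l, S.baseEval M g x l = y l := by
  have hadd : ∀ (u : M ⊗[K] S.H) (l l' : L),
      S.baseEval M u x (l + l') = S.baseEval M u x l + S.baseEval M u x l' := by
    intro u l l'
    induction u with
    | zero => simp
    | add u v hu hv => simp only [map_add, Pi.add_apply, hu, hv]; ring
    | tmul m h => simp [mul_add]
  have hsmul : ∀ (u : M ⊗[K] S.H) (k : K) (l : L),
      S.baseEval M u x (k • l) = k • S.baseEval M u x l := by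
    intro u k l
    induction u with
    | zero => simp
    | add u v hu hv => simp only [map_add, Pi.add_apply, hu, hv, smul_add]
    | tmul m h => simp
  refine ⟨AlgHom.ofLinearMap ⟨⟨S.baseEval M g x, hadd g⟩, hsmul g⟩ ?_ ?_, fun l => rfl⟩
  · change S.baseEval M g x 1 = 1
    rw [baseEval_one_arg, hg.counit_eq_one]
  · intro l l'
    change S.baseEval M g x (l * l') = S.baseEval M g x l * S.baseEval M g x l'
    rw [baseEval_mul_arg, hg.comul_eq_tmul_self]
    rfl

theorem exists_baseEval_eq_end (x : L →ₐ[K] M) (T : Module.End K L) :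
    ∃ u, ∀ l, S.baseEval M u x l = x (T l) := by
  obtain ⟨w, rfl⟩ := S.bijective.2 T
  induction w with
  | zero => exact ⟨0, by simp⟩
  | add w w' hw hw' =>
    obtain ⟨u, hu⟩ := hw
    obtain ⟨u', hu'⟩ := hw'
    exact ⟨u + u', fun l => by
      rw [map_add, map_add, Pi.add_apply, Pi.add_apply, hu, hu', LinearMap.add_apply, map_add]⟩
  | tmul a h => exact ⟨x a ⊗ₜ h, fun l => by simp⟩

/-- Surjectivity of `L ⊗ H → End_K(L)` supplies the coordinate projections, and `y` is an
`M`-combination of these. -/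
theorem exists_baseEval_eq [FiniteDimensional K L] (x y : L →ₐ[K] M) :
    ∃ u, ∀ l, S.baseEval M u x l = y l := by
  let b := Module.finBasis K L
  choose u hu using fun i => S.exists_baseEval_eq_end x ((Algebra.linearMap K L) ∘ₗ b.coord i)
  refine ⟨∑ i, y (b i) • u i, fun l => ?_⟩
  conv_rhs => rw [← b.sum_repr l]
  simp only [map_sum, map_smul, Finset.sum_apply, Pi.smul_apply, hu]
  exact Finset.sum_congr rfl fun i _ => by simp [Algebra.smul_def, mul_comm]

theorem baseEval_mem_span (u : M ⊗[K] S.H) : S.baseEval M u ∈ Submodule.span M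
    (evalMap K L M L '' (Set.range fun h => (S.action h : L → L))) := by
  induction u with
  | zero => simp
  | add u v hu hv => rw [map_add]; exact add_mem hu hv
  | tmul m h =>
    have h1 : S.baseEval M (m ⊗ₜ h) = m • evalMap K L M L (S.action h) := by
      ext x l; simp
    rw [h1]
    exact Submodule.smul_mem _ _ (Submodule.subset_span ⟨_, ⟨h, rfl⟩, rfl⟩)

theorem baseEval_map_galois (u : M ⊗[K] S.H) (σ : Gal(M/K)) (x : L →ₐ[K] M) (l : L) :
    S.baseEval M (TensorProduct.map (σ : M →ₐ[K] M).toLinearMap LinearMap.id u)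
      (galPerm K L M σ x) l = σ (S.baseEval M u x l) := by
  induction u with
  | zero => simp
  | add u v hu hv => simp only [map_add, Pi.add_apply, hu, hv]
  | tmul m h => simp

/-- A Hopf Galois structure of abelian type comes from a regular permutation group normalised by
the Galois group. -/
theorem exists_regular_of_hasType {N : Type*} [CommGroup N] [Nonempty (L →ₐ[K] M)]
    [FiniteDimensional K L] [FiniteDimensional K M] [IsGalois K M]
    [Algebra.IsSeparable K L] [IsNormalClosure K L M]
    (hN : Nat.card N = Module.finrank K L) (hS : S.HasType M N) :
    ∃ π : N →* Equiv.Perm (L →ₐ[K] M), (∀ x y : L →ₐ[K] M, ∃! η, π η x = y) ∧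
      (∀ (σ : Gal(M/K)) (η : N), ∃ θ, π θ = galPerm K L M σ * π η * (galPerm K L M σ)⁻¹) ∧
      Set.range S.action = translationAlgebra π := by
  obtain ⟨e⟩ := hS
  have : Finite N := Nat.finite_of_card_ne_zero (hN ▸ Module.finrank_pos.ne')
  let g : N →* M ⊗[K] S.H := (e.symm : MonoidAlgebra M N →* M ⊗[K] S.H).comp (MonoidAlgebra.of M N)
  have hg : ∀ η, g η = e.symm (MonoidAlgebra.single η 1) := fun _ => rfl
  have hgl : ∀ η, IsGroupLikeElem M (g η) := fun η =>
    (MonoidAlgebra.isGroupLikeElem_of η).map e.symm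
  choose f hf using fun η => S.exists_algHom_of_groupLike (hgl η)
  have f_mul : ∀ η θ x, f (η * θ) x = f θ (f η x) := by
    intro η θ x
    ext l
    rw [← hf, ← hf, map_mul, S.baseEval_mul (g η) (g θ) (f η) (hf η)]
  let F : N →* Function.End (L →ₐ[K] M) :=
    { toFun := f
      map_one' := by
        funext x
        ext l
        rw [← hf, map_one]
        simp only [Algebra.TensorProduct.one_def, baseEval_tmul, map_one, one_mul]
        rfl
      map_mul' := fun η θ => by
        funext x
        -- Group-like elements compose in reverse order, so `f` is a homomorphism because `N` is
        -- commutative.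
        rw [mul_comm, f_mul]
        rfl }
  let π : N →* Equiv.Perm (L →ₐ[K] M) := F.toHomPerm
  have hπ : ∀ η x l, S.baseEval M (g η) x l = π η x l := hf
  have hperm : ∀ c, permEval π c = S.baseEval M (e.symm c) := by
    intro c
    induction c using MonoidAlgebra.induction_linear with
    | zero => simp
    | add c d hc hd => simp only [map_add, hc, hd]
    | single η a =>
      have h : MonoidAlgebra.single η a = a • MonoidAlgebra.single η (1 : M) := by
        rw [MonoidAlgebra.smul_single, smul_eq_mul, mul_one]
      ext x l
      rw [h, map_smul, map_smul, map_smul, ← hg, Pi.smul_apply, Pi.smul_apply, Pi.smul_apply,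
        Pi.smul_apply, hπ, permEval_single, one_mul]
  -- Every embedding `y` lies in the `M`-span of the orbit of `x`; by linear independence of
  -- embeddings it belongs to the orbit. Regularity then follows from `|N| = |X|`.
  have htrans : ∀ x y : L →ₐ[K] M, ∃ η, π η x = y := by
    intro x y
    obtain ⟨u, hu⟩ := S.exists_baseEval_eq x y
    have hmem : ∀ c, permEval π c x ∈ Submodule.span M
        ((fun (z : L →ₐ[K] M) => (fun l => z l : L → M)) '' Set.range fun η => π η x) := by
      intro c
      induction c using MonoidAlgebra.induction_linear with
      | zero => simp
      | add c d hc hd => rw [map_add]; exact add_mem hc hd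
      | single η a =>
        have h : permEval π (MonoidAlgebra.single η a) x = a • (fun l => π η x l) := by
          ext l; simp
        rw [h]
        exact Submodule.smul_mem _ _ (Submodule.subset_span ⟨_, ⟨η, rfl⟩, rfl⟩)
    have hy : (fun l => y l : L → M) = permEval π (e u) x := by
      ext l
      rw [hperm, BialgEquiv.symm_apply_apply, hu]
    by_contra hne
    exact algHom_linearIndependent.notMem_span_image hne (hy ▸ hmem (e u))
  have hreg : ∀ x y : L →ₐ[K] M, ∃! η, π η x = y := by
    intro x
    refine (Function.bijective_iff_existsUnique _).1
      (Function.Surjective.bijective_of_nat_card_le (htrans x) ?_)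
    rw [hN, card_embeddings]
  refine ⟨π, hreg, fun σ η => ?_, Set.Subset.antisymm ?_ ?_⟩
  · obtain ⟨θ, hθ⟩ := exists_perm_eq_of_permEval π hreg
      (e (TensorProduct.map (σ : M →ₐ[K] M).toLinearMap LinearMap.id (g η)))
      (galPerm K L M σ * π η * (galPerm K L M σ)⁻¹) (fun x l => by
        rw [hperm, BialgEquiv.symm_apply_apply]
        have h := S.baseEval_map_galois (g η) σ ((galPerm K L M σ)⁻¹ x) l
        rw [hπ] at h
        have h2 : galPerm K L M σ ((galPerm K L M σ)⁻¹ x) = x :=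
          (galPerm K L M σ).apply_symm_apply x
        rw [h2] at h
        exact h)
    exact ⟨θ, Equiv.ext hθ⟩
  · rintro _ ⟨h, rfl⟩
    refine ⟨e (1 ⊗ₜ h), fun x l => ?_⟩
    rw [hperm, BialgEquiv.symm_apply_apply, baseEval_tmul, one_mul]
  · rintro T ⟨c, hc⟩
    let φ : Module.End K L →ₗ[K] (L → L) :=
      { toFun := fun T => T, map_add' := fun _ _ => rfl, map_smul' := fun _ _ => rfl }
    have h1 := mem_of_evalMap_mem_span (M := M) (LinearMap.range (φ ∘ₗ S.action.toLinearMap)) T (by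
      have h2 : evalMap K L M L T = S.baseEval M (e.symm c) := by
        ext x l
        rw [← hperm, hc, evalMap_apply]
      rw [h2]
      exact S.baseEval_mem_span _)
    obtain ⟨h, hh⟩ := h1
    exact ⟨h, DFunLike.coe_injective hh⟩

end HopfGaloisStructure

end Classification

/-! ### The Greither–Pareigis correspondence and its count. -/

section Counting

variable {K : Type u} {L : Type v} {M : Type w} [Field K] [Field L] [Field M]
  [Algebra K L] [Algebra K M]

namespace HopfGaloisStructure

theorem action_injective (S : HopfGaloisStructure K L) : Function.Injective S.action := by
  rw [injective_iff_map_eq_zero]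
  intro h hh
  let b := Module.finBasis K S.H
  let c := Algebra.TensorProduct.basis L b
  have h1 : (1 : L) ⊗ₜ[K] h = 0 := S.bijective.1 (by
    rw [map_zero]
    ext l
    simp [hh])
  have h2 : b.repr h = 0 := by
    ext i
    have h3 : c.repr ((1 : L) ⊗ₜ[K] h) i = 0 := by rw [h1]; simp
    simpa [c, Algebra.TensorProduct.basis_repr_tmul] using h3
  simpa using h2

/-- Injectivity of `L ⊗ H → End_K(L)` is used twice, once for each tensor factor. -/
theorem pairAction_injective (S : HopfGaloisStructure K L) :
    Function.Injective (pairAction S.action.toLinearMap) := by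
  let b := Module.finBasis K S.H
  let c := Algebra.TensorProduct.basis L b
  have hb : ∀ a : Fin (Module.finrank K S.H) → L,
      (∀ l, ∑ i, a i * S.action (b i) l = 0) → ∀ i, a i = 0 := by
    intro a ha
    have h1 : ∑ i, a i • c i = 0 := S.bijective.1 (by
      rw [map_zero]
      ext l
      rw [map_sum, LinearMap.sum_apply, LinearMap.zero_apply, ← ha l]
      refine Finset.sum_congr rfl fun i _ => ?_
      rw [Algebra.TensorProduct.basis_apply, TensorProduct.smul_tmul', smul_eq_mul, mul_one]
      rfl)
    exact Fintype.linearIndependent_iff.1 c.linearIndependent a h1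
  rw [injective_iff_map_eq_zero]
  intro u hu
  rw [← (b.tensorProduct b).sum_repr u] at hu ⊢
  set a := (b.tensorProduct b).repr u
  rw [Fintype.sum_prod_type] at hu ⊢
  have h1 : ∀ i j, algebraMap K L (a (i, j)) = 0 := by
    intro i
    apply hb
    intro l'
    refine hb (fun i => ∑ j, algebraMap K L (a (i, j)) * S.action (b j) l') (fun l => ?_) i
    have h2 := congrFun hu (l, l')
    simp only [map_sum, map_smul, Finset.sum_apply, Pi.smul_apply, Pi.zero_apply] at h2
    rw [← h2]
    refine Finset.sum_congr rfl fun i _ => ?_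
    rw [Finset.sum_mul]
    refine Finset.sum_congr rfl fun j _ => ?_
    rw [Module.Basis.tensorProduct_apply, Algebra.smul_def, mul_assoc, mul_comm (S.action (b j) l')]
    rfl
  refine Finset.sum_eq_zero fun i _ => Finset.sum_eq_zero fun j _ => ?_
  rw [(map_eq_zero _).1 (h1 i j), zero_smul]

/-- `H` embeds in `End_K(L)`, and the action determines the coalgebra: the counit is the value at
`1`, and `Δ h` is determined by `h (l l')` through injectivity of the pair action. -/
theorem iso_iff_range_eq (S T : HopfGaloisStructure K L) :
    S.Iso T ↔ Set.range S.action = Set.range T.action := by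
  constructor
  · rintro ⟨e, he⟩
    apply Set.Subset.antisymm
    · rintro _ ⟨h, rfl⟩
      exact ⟨e h, he h⟩
    · rintro _ ⟨h, rfl⟩
      exact ⟨e.symm h, by rw [← he, BialgEquiv.apply_symm_apply]⟩
  · intro hr
    have hr' : S.action.range = T.action.range := SetLike.coe_injective hr
    let e : S.H ≃ₐ[K] T.H := ((AlgEquiv.ofInjective _ S.action_injective).trans
      (Subalgebra.equivOfEq _ _ hr')).trans (AlgEquiv.ofInjective _ T.action_injective).symm
    have he : ∀ h, T.action (e h) = S.action h := fun h =>
      congrArg Subtype.val ((AlgEquiv.ofInjective _ T.action_injective).apply_symm_apply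
        (Subalgebra.equivOfEq _ _ hr' (AlgEquiv.ofInjective _ S.action_injective h)))
    refine ⟨BialgEquiv.ofAlgEquiv e ?_ ?_, he⟩
    · ext h
      apply (algebraMap K L).injective
      change algebraMap K L (Coalgebra.counit (R := K) (e h)) =
        algebraMap K L (Coalgebra.counit (R := K) h)
      rw [← T.action_one, he, S.action_one]
    · ext h
      apply T.pairAction_injective
      change pairAction T.action.toLinearMap
        (Algebra.TensorProduct.map (e : S.H →ₐ[K] T.H) (e : S.H →ₐ[K] T.H)
          (Coalgebra.comul (R := K) h)) =
        pairAction T.action.toLinearMap (Coalgebra.comul (R := K) (e h))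
      have key : ∀ u : S.H ⊗[K] S.H, pairAction T.action.toLinearMap
          (Algebra.TensorProduct.map (e : S.H →ₐ[K] T.H) (e : S.H →ₐ[K] T.H) u) =
          pairAction S.action.toLinearMap u := by
        intro u
        induction u with
        | zero => simp
        | add u v hu hv => simp only [map_add, hu, hv]
        | tmul a b =>
          ext l
          change T.action (e a) l.1 * T.action (e b) l.2 = S.action a l.1 * S.action b l.2
          rw [he, he]
      rw [key]
      ext l
      exact (S.action_mul h l.1 l.2).symm.trans
        ((by rw [he] : S.action h (l.1 * l.2) = T.action (e h) (l.1 * l.2)).trans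
          (T.action_mul (e h) l.1 l.2))

end HopfGaloisStructure

/-- The regular subgroups of `Perm X` isomorphic to `N` and normalised by a permutation
representation `ρ`. -/
structure IsRegularNormalized {G X : Type*} [Group G] (ρ : G →* Equiv.Perm X) (N : Type*) [Group N]
    (Q : Subgroup (Equiv.Perm X)) : Prop where
  regular : ∀ x y : X, ∃! η : Q, (η : Equiv.Perm X) x = y
  iso : Nonempty (N ≃* Q)
  normalized : ∀ σ, ∀ η ∈ Q, ρ σ * η * (ρ σ)⁻¹ ∈ Q

theorem IsRegularNormalized.exists_hom {G X : Type*} [Group G] {ρ : G →* Equiv.Perm X}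
    {N : Type*} [Group N] {Q : Subgroup (Equiv.Perm X)} (h : IsRegularNormalized ρ N Q) :
    ∃ π : N →* Equiv.Perm X, π.range = Q ∧ (∀ x y, ∃! η, π η x = y) ∧
      ∀ σ η, ∃ θ, π θ = ρ σ * π η * (ρ σ)⁻¹ := by
  obtain ⟨e⟩ := h.iso
  refine ⟨Q.subtype.comp e.toMonoidHom, ?_, fun x y => ?_, fun σ η => ?_⟩
  · ext η
    refine ⟨?_, fun hη => ⟨e.symm ⟨η, hη⟩, by simp⟩⟩
    rintro ⟨a, rfl⟩
    exact (e a).2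
  · obtain ⟨η, hη, huniq⟩ := h.regular x y
    exact ⟨e.symm η, by simpa using hη, fun θ hθ => by rw [← huniq (e θ) hθ]; simp⟩
  · exact ⟨e.symm ⟨_, h.normalized σ _ (e η).2⟩, by simp⟩

theorem isRegularNormalized_range {G X : Type*} [Group G] [Nonempty X] {ρ : G →* Equiv.Perm X}
    {N : Type*} [Group N] (π : N →* Equiv.Perm X) (hreg : ∀ x y, ∃! η, π η x = y)
    (hnorm : ∀ σ η, ∃ θ, π θ = ρ σ * π η * (ρ σ)⁻¹) : IsRegularNormalized ρ N π.range := by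
  have hinj : Function.Injective π := fun η θ h =>
    (hreg (Classical.arbitrary _) (π θ (Classical.arbitrary _))).unique (by rw [h]) rfl
  refine ⟨fun x y => ?_, ⟨MonoidHom.ofInjective hinj⟩, ?_⟩
  · obtain ⟨η, hη, huniq⟩ := hreg x y
    refine ⟨⟨π η, η, rfl⟩, hη, ?_⟩
    rintro ⟨_, θ, rfl⟩ hθ
    exact Subtype.ext (congrArg π (huniq θ hθ))
  · rintro σ _ ⟨η, rfl⟩
    exact hnorm σ η

section

variable [FiniteDimensional K L] [Algebra.IsSeparable K L] [IsNormalClosure K L M]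
  {N : Type*} [CommGroup N] (hN : Nat.card N = Module.finrank K L)
include hN

theorem exists_hasType_iff : (∃ S : HopfGaloisStructure K L, S.HasType M N) ↔
    ∃ Q, IsRegularNormalized (galPerm K L M) N Q := by
  have := finiteDimensional_normalClosure (K := K) (L := L) (M := M)
  have := isGalois_normalClosure (K := K) (L := L) (M := M)
  have hX : 0 < Nat.card (L →ₐ[K] M) := by rw [card_embeddings]; exact Module.finrank_pos
  have : Nonempty (L →ₐ[K] M) := (Nat.card_pos_iff.1 hX).1
  constructor
  · rintro ⟨S, hS⟩
    obtain ⟨π, hreg, hnorm, -⟩ := S.exists_regular_of_hasType hN hS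
    exact ⟨_, isRegularNormalized_range π hreg hnorm⟩
  · rintro ⟨Q, hQ⟩
    obtain ⟨π, -, hreg, hnorm⟩ := hQ.exists_hom
    exact ⟨_, hopfGaloisOfRegular_hasType π hreg hnorm⟩

/-- The Greither–Pareigis correspondence for abelian types. -/
theorem numberOfType_eq_card : HopfGaloisStructure.numberOfType K L M N =
    Nat.card {Q // IsRegularNormalized (galPerm K L M) N Q} := by
  have := finiteDimensional_normalClosure (K := K) (L := L) (M := M)
  have := isGalois_normalClosure (K := K) (L := L) (M := M)
  have hX : 0 < Nat.card (L →ₐ[K] M) := by rw [card_embeddings]; exact Module.finrank_pos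
  have : Nonempty (L →ₐ[K] M) := (Nat.card_pos_iff.1 hX).1
  choose π hrange hreg hnorm using fun Q : {Q // IsRegularNormalized (galPerm K L M) N Q} =>
    Q.2.exists_hom
  symm
  refine Nat.card_congr (Equiv.ofBijective (fun Q => ⟨Quotient.mk _
    (hopfGaloisOfRegular (π Q) (hreg Q) (hnorm Q)), _, rfl,
      hopfGaloisOfRegular_hasType (π Q) (hreg Q) (hnorm Q)⟩) ⟨?_, ?_⟩)
  · intro Q Q' h
    have h1 := Quotient.exact (congrArg Subtype.val h)
    have h2 := (HopfGaloisStructure.iso_iff_range_eq _ _).1 h1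
    rw [range_hopfGaloisOfRegular, range_hopfGaloisOfRegular] at h2
    have h3 : translationAlgebra (π Q) = translationAlgebra (π Q') := SetLike.coe_injective h2
    apply Subtype.ext
    rw [← hrange Q, ← hrange Q']
    exact le_antisymm
      (range_le_of_translationAlgebra_le _ (hreg Q) (hnorm Q) _ (hreg Q') h3.le)
      (range_le_of_translationAlgebra_le _ (hreg Q') (hnorm Q') _ (hreg Q) h3.ge)
  · rintro ⟨_, S, rfl, hS⟩
    obtain ⟨π', hreg', hnorm', hS'⟩ := S.exists_regular_of_hasType hN hS
    let Q : {Q // IsRegularNormalized (galPerm K L M) N Q} :=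
      ⟨_, isRegularNormalized_range π' hreg' hnorm'⟩
    refine ⟨Q, Subtype.ext (Quotient.sound ?_)⟩
    refine (HopfGaloisStructure.iso_iff_range_eq _ _).2 ?_
    rw [range_hopfGaloisOfRegular, hS', SetLike.coe_set_eq]
    exact le_antisymm (translationAlgebra_le_of_range_le _ _ (hrange Q).le)
      (translationAlgebra_le_of_range_le _ _ (hrange Q).ge)

end

end Counting

/-! ### Arithmetic of `ℤ/p²` and the affine permutations `tau d`. -/

section Affine

theorem cast_prime_mul_self {p : ℕ} : (p : ZMod (p ^ 2)) * p = 0 := by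
  rw [← Nat.cast_mul, ← sq, ZMod.natCast_self]

variable {p : ℕ} [Fact p.Prime]

theorem prime_mul_eq_zero_iff (d : ZMod (p ^ 2)) :
    (p : ZMod (p ^ 2)) * d = 0 ↔ ∃ e, d = (p : ZMod (p ^ 2)) * e := by
  constructor
  · intro h
    rw [← ZMod.natCast_zmod_val d, ← Nat.cast_mul, ZMod.natCast_eq_zero_iff] at h
    obtain ⟨e, he⟩ := Nat.dvd_of_mul_dvd_mul_left (Fact.out : p.Prime).pos
      ((dvd_of_eq (sq p).symm).trans h)
    exact ⟨e, by rw [← ZMod.natCast_zmod_val d, he, Nat.cast_mul]⟩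
  · rintro ⟨e, rfl⟩
    rw [← mul_assoc, cast_prime_mul_self, zero_mul]

theorem mul_eq_zero_of_prime_mul {d d' : ZMod (p ^ 2)} (h : (p : ZMod (p ^ 2)) * d = 0)
    (h' : (p : ZMod (p ^ 2)) * d' = 0) :
    d * d' = 0 := by
  obtain ⟨e, rfl⟩ := (prime_mul_eq_zero_iff d).1 h
  rw [mul_right_comm, h', zero_mul]

theorem isUnit_of_prime_mul_ne_zero {z : ZMod (p ^ 2)} (h : (p : ZMod (p ^ 2)) * z ≠ 0) :
    IsUnit z := by
  have hp : p.Prime := Fact.out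
  rw [← ZMod.natCast_zmod_val z, ZMod.isUnit_iff_coprime]
  refine Nat.Coprime.pow_right 2 ((Nat.coprime_comm.1 ((Nat.Prime.coprime_iff_not_dvd hp).2 ?_)))
  rintro ⟨e, he⟩
  exact h ((prime_mul_eq_zero_iff z).2 ⟨e, by rw [← ZMod.natCast_zmod_val z, he, Nat.cast_mul]⟩)

/-- Fermat's little theorem: multiplication by `p` sees only residues modulo `p`. -/
theorem prime_mul_pow_prime (a : ZMod (p ^ 2)) :
    (p : ZMod (p ^ 2)) * a ^ p = (p : ZMod (p ^ 2)) * a := by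
  have h : (p : ℤ) ∣ (a.val : ℤ) ^ p - a.val := by
    rw [← ZMod.intCast_zmod_eq_zero_iff_dvd]
    push_cast
    rw [ZMod.pow_card, sub_self]
  obtain ⟨k, hk⟩ := h
  have h2 := congrArg (Int.cast : ℤ → ZMod (p ^ 2)) hk
  push_cast at h2
  rw [ZMod.natCast_zmod_val] at h2
  rw [← sub_eq_zero, ← mul_sub, h2, ← mul_assoc, cast_prime_mul_self, zero_mul]

theorem prime_mul_pow_prime_sq (a : ZMod (p ^ 2)) :
    (p : ZMod (p ^ 2)) * a ^ (p ^ 2) = (p : ZMod (p ^ 2)) * a := by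
  have h : a ^ (p ^ 2) = (a ^ p) ^ p := by rw [← pow_mul, ← sq]
  rw [h, prime_mul_pow_prime, prime_mul_pow_prime]

/-- The `p`-torsion of `ℤ/p²`. -/
abbrev PrimeTorsion (p : ℕ) : Type := {d : ZMod (p ^ 2) // (p : ZMod (p ^ 2)) * d = 0}

theorem card_primeTorsion : Nat.card (PrimeTorsion p) = p := by
  have hp : p.Prime := Fact.out
  refine Eq.trans (Eq.symm ?_) (Nat.card_fin p)
  refine Nat.card_congr (Equiv.ofBijective
    (fun i : Fin p => ⟨(p : ZMod (p ^ 2)) * ((i : ℕ) : ZMod (p ^ 2)),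
      (prime_mul_eq_zero_iff _).2 ⟨_, rfl⟩⟩) ⟨?_, ?_⟩)
  · intro i j h
    have h1 := congrArg Subtype.val h
    simp only [← Nat.cast_mul] at h1
    rw [ZMod.natCast_eq_natCast_iff'] at h1
    have hlt : ∀ i : Fin p, p * (i : ℕ) < p ^ 2 := fun i => by
      rw [sq]; exact Nat.mul_lt_mul_of_pos_left i.2 hp.pos
    rw [Nat.mod_eq_of_lt (hlt i), Nat.mod_eq_of_lt (hlt j)] at h1
    exact Fin.ext (Nat.eq_of_mul_eq_mul_left hp.pos h1)
  · rintro ⟨d, hd⟩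
    obtain ⟨e, rfl⟩ := (prime_mul_eq_zero_iff d).1 hd
    refine ⟨⟨e.val % p, Nat.mod_lt _ hp.pos⟩, Subtype.ext ?_⟩
    change (p : ZMod (p ^ 2)) * ((e.val % p : ℕ) : ZMod (p ^ 2)) = p * e
    conv_rhs => rw [← ZMod.natCast_zmod_val e, ← Nat.mod_add_div e.val p]
    push_cast
    rw [mul_add, ← mul_assoc, cast_prime_mul_self, zero_mul, add_zero]

omit [Fact p.Prime] in
theorem two_mul_inv_two (hodd : Odd p) : (2 : ZMod (p ^ 2)) * 2⁻¹ = 1 := by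
  have := ZMod.coe_mul_inv_eq_one (n := p ^ 2) 2 (Nat.Coprime.pow_right 2
    (Nat.coprime_two_left.2 hodd))
  exact_mod_cast this

theorem one_add_pow {d : ZMod (p ^ 2)} (hd : (p : ZMod (p ^ 2)) * d = 0) (n : ℕ) :
    (1 + d) ^ n = 1 + (n : ZMod (p ^ 2)) * d := by
  induction n with
  | zero => simp
  | succ n ih =>
    rw [pow_succ (1 + d) n, ih]
    push_cast
    linear_combination (n : ZMod (p ^ 2)) * mul_eq_zero_of_prime_mul hd hd

/-- The permutation `z ↦ (1 + d.1) z + 1` of `ℤ/p²`, where `p d = 0`. -/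
def tau (d : PrimeTorsion p) : Equiv.Perm (ZMod (p ^ 2)) where
  toFun z := (1 + d.1) * z + 1
  invFun z := (1 - d.1) * (z - 1)
  left_inv z := by
    linear_combination (-z) * mul_eq_zero_of_prime_mul d.2 d.2
  right_inv z := by
    linear_combination (1 - z) * mul_eq_zero_of_prime_mul d.2 d.2

variable (d : PrimeTorsion p)

@[simp] theorem tau_apply (z : ZMod (p ^ 2)) : tau d z = (1 + d.1) * z + 1 := rfl

/-- As `d² = 0`, the linear part is `(1 + d)ⁿ = 1 + n d`, and the translation part is `∑_{k<n} (1 +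
k d)`. Oddness of `p` makes `2` invertible. -/
theorem tau_pow_apply (hodd : Odd p) (n : ℕ) (z : ZMod (p ^ 2)) :
    (tau d ^ n) z = (1 + n * d.1) * z + n + d.1 * 2⁻¹ * n * (n - 1) := by
  induction n with
  | zero => simp
  | succ n ih =>
    have h1 := mul_eq_zero_of_prime_mul d.2 d.2
    rw [pow_succ' (tau d) n, Equiv.Perm.mul_apply, ih, tau_apply]
    push_cast
    linear_combination (n * z + 2⁻¹ * n * (n - 1)) * h1 - d.1 * n * two_mul_inv_two hodd

theorem mem_zpowers_tau_iff (hodd : Odd p) (f : Equiv.Perm (ZMod (p ^ 2))) :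
    f ∈ Subgroup.zpowers (tau d) ↔ ∃ n : ZMod (p ^ 2), ∀ z,
      f z = (1 + n * d.1) * z + n + d.1 * 2⁻¹ * n * (n - 1) := by
  constructor
  · intro h
    rw [← mem_powers_iff_mem_zpowers] at h
    obtain ⟨n, rfl⟩ := h
    exact ⟨n, tau_pow_apply d hodd n⟩
  · rintro ⟨n, hn⟩
    refine ⟨n.val, Equiv.ext fun z => ?_⟩
    rw [hn]
    change (tau d ^ (n.val : ℤ)) z = _
    rw [zpow_natCast, tau_pow_apply d hodd, ZMod.natCast_zmod_val]

theorem exists_zpowers_tau_apply (hodd : Odd p) (z : ZMod (p ^ 2)) :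
    ∃ f ∈ Subgroup.zpowers (tau d), f 0 = z := by
  -- First-order solution in `d` of `n + d n (n - 1) / 2 = z`, exact because `d² = 0`.
  let n := z - d.1 * 2⁻¹ * z * (z - 1)
  refine ⟨tau d ^ n.val, Subgroup.npow_mem_zpowers _ _, ?_⟩
  rw [tau_pow_apply d hodd, ZMod.natCast_zmod_val]
  have h1 := mul_eq_zero_of_prime_mul d.2 d.2
  simp only [n]
  linear_combination (-(2⁻¹ * 2⁻¹ * z * (z - 1) * (2 * z - 1)) +
    d.1 * 2⁻¹ * 2⁻¹ * 2⁻¹ * z ^ 2 * (z - 1) ^ 2) * h1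

theorem existsUnique_of_commute_of_transitive {X : Type*} (Q : Subgroup (Equiv.Perm X))
    (hc : ∀ f ∈ Q, ∀ g ∈ Q, f * g = g * f) (x₀ : X) (ht : ∀ y, ∃ f ∈ Q, f x₀ = y) (x y : X) :
    ∃! f : Q, (f : Equiv.Perm X) x = y := by
  obtain ⟨f, hf, rfl⟩ := ht x
  obtain ⟨g, hg, rfl⟩ := ht y
  refine ⟨⟨g * f⁻¹, Q.mul_mem hg (Q.inv_mem hf)⟩, by simp, ?_⟩
  rintro ⟨k, hk⟩ h
  apply Subtype.ext
  ext z
  obtain ⟨l, hl, rfl⟩ := ht z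
  change k (l x₀) = (g * f⁻¹) (l x₀)
  have h1 : (k * f) x₀ = g x₀ := h
  have h2 : k (l x₀) = (l * f⁻¹ * (k * f)) x₀ := by
    have : l * f⁻¹ * (k * f) = k * l := by
      rw [hc _ hk _ hf, ← mul_assoc, mul_assoc l, inv_mul_cancel, mul_one, hc _ hl _ hk]
    rw [this]; rfl
  rw [h2, Equiv.Perm.mul_apply, h1, ← Equiv.Perm.mul_apply, ← Equiv.Perm.mul_apply,
    hc _ (Q.mul_mem hl (Q.inv_mem hf)) _ hg, hc _ hl _ (Q.inv_mem hf), mul_assoc]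

theorem zpowers_tau_regular (hodd : Odd p) (x y : ZMod (p ^ 2)) :
    ∃! f : Subgroup.zpowers (tau d), (f : Equiv.Perm (ZMod (p ^ 2))) x = y := by
  refine existsUnique_of_commute_of_transitive _ ?_ 0 (exists_zpowers_tau_apply d hodd) x y
  rintro _ ⟨m, rfl⟩ _ ⟨n, rfl⟩
  exact (Commute.refl (tau d)).zpow_zpow m n

theorem card_eq_of_regular {X : Type*} (Q : Subgroup (Equiv.Perm X)) (x : X)
    (h : ∀ y, ∃! f : Q, (f : Equiv.Perm X) x = y) : Nat.card Q = Nat.card X :=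
  Nat.card_congr (Equiv.ofBijective (fun f : Q => (f : Equiv.Perm X) x)
    ((Function.bijective_iff_existsUnique _).2 h))

theorem card_zpowers_tau (hodd : Odd p) : Nat.card (Subgroup.zpowers (tau d)) = p ^ 2 := by
  rw [card_eq_of_regular _ 0 (zpowers_tau_regular d hodd 0), Nat.card_zmod]

theorem affine_of_apply_add_one {n : ℕ} [NeZero n] (f : ZMod n → ZMod n) (k : ZMod n)
    (h : ∀ z, f (z + 1) = f z + k) (z : ZMod n) : f z = k * z + f 0 := by
  rw [← ZMod.natCast_zmod_val z]
  generalize z.val = m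
  induction m with
  | zero => simp
  | succ m ih => push_cast; rw [h, ih]; ring

/-- An affine permutation normalises `⟨tau d⟩` iff its linear part acts trivially on `d`. -/
theorem conj_tau_mem_iff (hodd : Odd p) (f : Equiv.Perm (ZMod (p ^ 2))) (a b : ZMod (p ^ 2))
    (hf : ∀ z, f z = a * z + b) :
    f * tau d * f⁻¹ ∈ Subgroup.zpowers (tau d) ↔ (a - 1) * d.1 = 0 := by
  have h1 := mul_eq_zero_of_prime_mul d.2 d.2
  rw [mem_zpowers_tau_iff d hodd]
  have hconj : ∀ n : ZMod (p ^ 2), (∀ z, (f * tau d * f⁻¹) z =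
      (1 + n * d.1) * z + n + d.1 * 2⁻¹ * n * (n - 1)) ↔ ∀ z, a * ((1 + d.1) * z + 1) + b =
      (1 + n * d.1) * (a * z + b) + n + d.1 * 2⁻¹ * n * (n - 1) := by
    intro n
    rw [← f.forall_congr_right]
    refine forall_congr' fun z => ?_
    rw [Equiv.Perm.mul_apply, Equiv.Perm.mul_apply, ← hf, ← hf, ← tau_apply]
    rw [show f⁻¹ (f z) = z from f.symm_apply_apply z]
  constructor
  · rintro ⟨n, hn⟩
    rw [hconj] at hn
    have ha : IsUnit a := by
      obtain ⟨z, hz⟩ := f.surjective (b + 1)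
      rw [hf] at hz
      exact IsUnit.of_mul_eq_one z (by linear_combination hz)
    have h2 : n * d.1 = d.1 := by
      apply ha.mul_left_cancel
      linear_combination hn 0 - hn 1
    have h3 := hn 0
    linear_combination d.1 * h3 + h2 + (n * b + 2⁻¹ * n * (n - 1)) * h1
  · intro h
    -- With `a d = d` and `d² = 0` the quadratic term vanishes, and comparing constant terms forces
    -- `n = a - b d`.
    refine ⟨a - b * d.1, (hconj _).2 fun z => ?_⟩
    linear_combination (-(a * z) - b - 2⁻¹ * (a - b * d.1)) * h +
      (a * z * b + b ^ 2 + 2⁻¹ * (a - b * d.1) * b) * h1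

end Affine

/-! ### Regular cyclic subgroups normalised by an affine group. -/

section RegularSubgroups

variable {p : ℕ} {G : Type*} [Group G] (ρ : G →* Equiv.Perm (ZMod (p ^ 2)))

/-- A permutation representation on `ℤ/p²` by affine maps. -/
def IsAffineRep : Prop :=
  ∀ σ, ∃ a b, ∀ z, ρ σ z = a * z + b

variable {ρ} (hρ : IsAffineRep ρ)
include hρ

theorem IsAffineRep.apply_eq (σ : G) (z : ZMod (p ^ 2)) :
    ρ σ z = (ρ σ 1 - ρ σ 0) * z + ρ σ 0 := by
  obtain ⟨a, b, h⟩ := hρ σ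
  rw [h, h, h]
  ring

/-- The linear part of an affine representation. -/
def IsAffineRep.linearPart : G →* ZMod (p ^ 2) where
  toFun σ := ρ σ 1 - ρ σ 0
  map_one' := by simp
  map_mul' σ τ := by
    rw [map_mul, Equiv.Perm.mul_apply, Equiv.Perm.mul_apply, hρ.apply_eq σ (ρ τ 1),
      hρ.apply_eq σ (ρ τ 0)]
    ring

theorem IsAffineRep.apply_eq_linearPart (σ : G) (z : ZMod (p ^ 2)) :
    ρ σ z = hρ.linearPart σ * z + ρ σ 0 := hρ.apply_eq σ z

variable [Fact p.Prime]

omit hρ in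
/-- A regular cyclic subgroup normalised by the translation by `1` is some `⟨tau d⟩`. -/
theorem exists_eq_zpowers_tau (hodd : Odd p) {Q : Subgroup (Equiv.Perm (ZMod (p ^ 2)))}
    (hQ : IsRegularNormalized ρ (CyclicGrp (p ^ 2)) Q) (σ : G) (hσ : ∀ z, ρ σ z = z + 1) :
    ∃ d, Q = Subgroup.zpowers (tau d) := by
  obtain ⟨e⟩ := hQ.iso
  set t := ρ σ with ht
  let γ : ZMod (p ^ 2) → Equiv.Perm (ZMod (p ^ 2)) := fun n => (e (Multiplicative.ofAdd n)).1
  have γ_add : ∀ m n, γ (m + n) = γ m * γ n := fun m n => by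
    simp only [γ, ofAdd_add, map_mul]; rfl
  have γ_zero : γ 0 = 1 := by simp only [γ, ofAdd_zero, map_one]; rfl
  have γ_mul : ∀ (k : ℕ) n, γ (k * n) = γ n ^ k := by
    intro k n
    induction k with
    | zero => simp [γ_zero]
    | succ k ih => rw [Nat.cast_succ, add_mul, one_mul, γ_add, ih, pow_succ (γ n) k]
  have γ_inj : Function.Injective γ := fun m n h =>
    Multiplicative.ofAdd.injective (e.injective (Subtype.ext h))
  have γ_surj : ∀ f ∈ Q, ∃ n, γ n = f := fun f hf =>
    ⟨Multiplicative.toAdd (e.symm ⟨f, hf⟩), by simp [γ]⟩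
  have γ_mem : ∀ n, γ n ∈ Q := fun n => (e _).2
  -- Conjugation by the translation `t` acts on `Q ≅ ℤ/p²` as multiplication by `r`. Since `t` has
  -- order dividing `p²`, so does `r`, and hence `r = 1 + p s`.
  obtain ⟨r, hr⟩ := γ_surj _ (hQ.normalized σ _ (γ_mem 1))
  have hconj : ∀ n, t * γ n = γ (r * n) * t := by
    intro n
    have h1 : γ n = γ 1 ^ n.val := by rw [← γ_mul, ZMod.natCast_zmod_val, mul_one]
    have h2 : γ (r * n) = γ r ^ n.val := by rw [← γ_mul, ZMod.natCast_zmod_val, mul_comm]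
    rw [h1, h2, hr, conj_pow, inv_mul_cancel_right]
  have hpow : ∀ k : ℕ, t ^ k * γ 1 = γ (r ^ k) * t ^ k := by
    intro k
    induction k with
    | zero => simp
    | succ k ih =>
      rw [pow_succ' t k, mul_assoc, ih, ← mul_assoc, hconj, mul_assoc, pow_succ' r k]
  have htpow : ∀ (k : ℕ) z, (t ^ k) z = z + k := by
    intro k z
    induction k with
    | zero => simp
    | succ k ih =>
      rw [pow_succ' t k, Equiv.Perm.mul_apply, ih, hσ]
      push_cast; ring
  have htone : t ^ (p ^ 2) = 1 := by
    ext1 z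
    rw [htpow, ZMod.natCast_self, add_zero]; rfl
  have hr1 : r ^ (p ^ 2) = 1 := by
    have h1 := hpow (p ^ 2)
    rw [htone, one_mul, mul_one] at h1
    exact (γ_inj h1).symm
  have hpr : (p : ZMod (p ^ 2)) * r = p := by
    rw [← prime_mul_pow_prime_sq r, hr1, mul_one]
  obtain ⟨s, hs⟩ := (prime_mul_eq_zero_iff (r - 1)).1 (by rw [mul_sub, hpr, mul_one, sub_self])
  set c := γ p 0 with hc
  -- `r p = p`, so `γ p` commutes with `t` and is a translation.
  have hγp : ∀ z, γ p z = z + c := by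
    intro z
    have h1 := affine_of_apply_add_one (γ p) 1 (fun z => by
      have h2 := DFunLike.congr_fun (hconj p) z
      rw [mul_comm r, hpr, Equiv.Perm.mul_apply, Equiv.Perm.mul_apply, hσ, hσ] at h2
      exact h2.symm) z
    rw [h1, one_mul]
  have hγps : ∀ (k : ℕ) z, γ (k * p) z = z + k * c := by
    intro k z
    rw [γ_mul]
    induction k with
    | zero => simp
    | succ k ih =>
      rw [pow_succ' (γ p) k, Equiv.Perm.mul_apply, ih, hγp]
      push_cast; ring
  have hpc : (p : ZMod (p ^ 2)) * c = 0 := by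
    have h1 := hγps p 0
    rw [cast_prime_mul_self, γ_zero] at h1
    simpa using h1.symm
  -- From `t γ₁ = γ_r t` and `γ_r = γ_{sp} γ₁`, where `γ_{sp}` is translation by `s c`: hence `γ₁`
  -- is affine.
  have hstep : ∀ z, γ 1 (z + 1) = γ 1 z + (1 - s * c) := by
    intro z
    have h1 := DFunLike.congr_fun (hconj 1) z
    have h2 : r * 1 = (s.val : ZMod (p ^ 2)) * p + 1 := by
      rw [ZMod.natCast_zmod_val]; linear_combination hs
    rw [h2, γ_add, Equiv.Perm.mul_apply, Equiv.Perm.mul_apply, Equiv.Perm.mul_apply, hσ, hσ,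
      hγps, ZMod.natCast_zmod_val] at h1
    linear_combination -h1
  have haff := affine_of_apply_add_one (γ 1) _ hstep
  set d : ZMod (p ^ 2) := -(s * c) with hd
  have hpd : (p : ZMod (p ^ 2)) * d = 0 := by rw [hd]; linear_combination (-s) * hpc
  have hdd := mul_eq_zero_of_prime_mul hpd hpd
  have hgpow : ∀ k : ℕ, ∃ b, ∀ z, (γ 1 ^ k) z = (1 + k * d) * z + b := by
    intro k
    induction k with
    | zero => exact ⟨0, by simp⟩
    | succ k ih =>
      obtain ⟨b, hb⟩ := ih
      refine ⟨(1 + d) * b + γ 1 0, fun z => ?_⟩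
      rw [pow_succ' (γ 1) k, Equiv.Perm.mul_apply, hb, haff]
      push_cast
      linear_combination k * z * hdd + ((1 + k * d) * z + b) * (-hd)
  -- The element of `Q` sending `0` to `1` is a power of `γ 1`, and this normalisation makes it a
  -- `tau`. Its powers are transitive, so regularity of `Q` leaves no other elements.
  obtain ⟨⟨η, hη⟩, hη1, -⟩ := hQ.regular 0 1
  obtain ⟨n, hn⟩ := γ_surj η hη
  obtain ⟨b, hb⟩ := hgpow n.val
  rw [← γ_mul, mul_one, ZMod.natCast_zmod_val, hn] at hb
  have hb1 : b = 1 := by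
    have h1 := hb 0
    rw [mul_zero, zero_add] at h1
    exact h1.symm.trans hη1
  have hητ : η = tau ⟨n * d, by linear_combination n * hpd⟩ := by
    ext1 z
    rw [hb, hb1, tau_apply]
  refine ⟨_, le_antisymm (fun f hf => ?_) (Subgroup.zpowers_le.2 (hητ ▸ hη))⟩
  obtain ⟨f', hf', h1⟩ := exists_zpowers_tau_apply ⟨n * d, by linear_combination n * hpd⟩ hodd (f 0)
  have hf'Q : f' ∈ Q := Subgroup.zpowers_le.2 (hητ ▸ hη) hf'
  have h2 := (hQ.regular 0 (f 0)).unique (y₁ := ⟨f, hf⟩) (y₂ := ⟨f', hf'Q⟩) rfl h1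
  rw [show f = f' from congrArg Subtype.val h2]
  exact hf'

theorem isRegularNormalized_zpowers_tau_iff (hodd : Odd p) (d : PrimeTorsion p) :
    IsRegularNormalized ρ (CyclicGrp (p ^ 2)) (Subgroup.zpowers (tau d)) ↔
      ∀ σ, (hρ.linearPart σ - 1) * d.1 = 0 := by
  constructor
  · intro h σ
    exact (conj_tau_mem_iff d hodd _ _ _ (hρ.apply_eq_linearPart σ)).1
      (h.normalized σ _ (Subgroup.mem_zpowers _))
  · intro h
    refine ⟨zpowers_tau_regular d hodd, ⟨mulEquivOfCyclicCardEq ?_⟩, ?_⟩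
    · rw [card_zpowers_tau d hodd, Nat.card_congr Multiplicative.toAdd, Nat.card_zmod]
    · rintro σ _ ⟨k, rfl⟩
      have h1 := (conj_tau_mem_iff d hodd _ _ _ (hρ.apply_eq_linearPart σ)).2 (h σ)
      change ρ σ * tau d ^ k * (ρ σ)⁻¹ ∈ _
      rw [← conj_zpow]
      exact Subgroup.zpow_mem _ h1 k

theorem card_isRegularNormalized (hodd : Odd p) (σ₁ : G) (hσ₁ : ∀ z, ρ σ₁ z = z + 1)
    {P : Prop} [Decidable P] (hP : P ↔ ∀ σ, (p : ZMod (p ^ 2)) * hρ.linearPart σ = p) :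
    Nat.card {Q // IsRegularNormalized ρ (CyclicGrp (p ^ 2)) Q} =
      if P then p else 1 := by
  have h1 : Nat.card {Q // IsRegularNormalized ρ (CyclicGrp (p ^ 2)) Q} =
      Nat.card {d : PrimeTorsion p // ∀ σ, (hρ.linearPart σ - 1) * d.1 = 0} := by
    symm
    refine Nat.card_congr (Equiv.ofBijective (fun d => ⟨Subgroup.zpowers (tau d.1),
      (isRegularNormalized_zpowers_tau_iff hρ hodd d.1).2 d.2⟩) ⟨?_, ?_⟩)
    · rintro ⟨d, hd⟩ ⟨d', hd'⟩ h
      have h2 : Subgroup.zpowers (tau d) = Subgroup.zpowers (tau d') := congrArg Subtype.val h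
      have h3 : tau d' ∈ Subgroup.zpowers (tau d) := h2 ▸ Subgroup.mem_zpowers _
      -- `tau d` is the only element of its group sending `0` to `1`, so the group determines `d`.
      have h4 := (zpowers_tau_regular d hodd 0 1).unique
        (y₁ := ⟨tau d, Subgroup.mem_zpowers _⟩) (y₂ := ⟨tau d', h3⟩) (by simp) (by simp)
      have h5 := DFunLike.congr_fun (congrArg Subtype.val h4) 1
      simp only [tau_apply, mul_one] at h5
      exact Subtype.ext (Subtype.ext (by linear_combination h5))
    · rintro ⟨Q, hQ⟩
      obtain ⟨d, rfl⟩ := exists_eq_zpowers_tau hodd hQ σ₁ hσ₁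
      exact ⟨⟨d, (isRegularNormalized_zpowers_tau_iff hρ hodd d).1 hQ⟩, rfl⟩
  rw [h1]
  split_ifs with h <;> rw [hP] at h
  · have h2 : ∀ d : PrimeTorsion p, ∀ σ, (hρ.linearPart σ - 1) * d.1 = 0 := fun d σ => by
      refine mul_eq_zero_of_prime_mul ?_ d.2
      linear_combination h σ
    rw [Nat.card_congr (Equiv.subtypeUnivEquiv h2), card_primeTorsion]
  · push Not at h
    obtain ⟨σ, hσ⟩ := h
    have h2 : IsUnit (hρ.linearPart σ - 1) := isUnit_of_prime_mul_ne_zero (by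
      rwa [mul_sub, mul_one, sub_ne_zero])
    rw [Nat.card_eq_one_iff_unique]
    refine ⟨⟨?_⟩, ⟨⟨⟨0, mul_zero _⟩, fun τ => mul_zero _⟩⟩⟩
    rintro ⟨d, hd⟩ ⟨d', hd'⟩
    have h3 : d.1 = 0 := h2.mul_left_cancel (by rw [hd σ, mul_zero])
    have h4 : d'.1 = 0 := h2.mul_left_cancel (by rw [hd' σ, mul_zero])
    exact Subtype.ext (Subtype.ext (h3.trans h4.symm))

end RegularSubgroups

/-! ### Transitive affine groups of `ℤ/p²` are semidirect products. -/

section Semidirect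

variable {p : ℕ} [Fact p.Prime] {G : Type*} [Group G]

theorem prime_mul_of_castHom_eq_one {z : ZMod (p ^ 2)}
    (h : ZMod.castHom (dvd_pow_self p two_ne_zero) (ZMod p) z = 1) :
    (p : ZMod (p ^ 2)) * z = p := by
  have h1 : ZMod.castHom (dvd_pow_self p two_ne_zero) (ZMod p) (z - 1) = 0 := by
    rw [map_sub, h, map_one, sub_self]
  rw [ZMod.castHom_apply, ← ZMod.natCast_val, ZMod.natCast_eq_zero_iff] at h1
  obtain ⟨e, he⟩ := h1
  have h2 : z - 1 = p * e := by
    rw [← Nat.cast_mul, ← he, ZMod.natCast_zmod_val]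
  have h3 := (prime_mul_eq_zero_iff (z - 1)).2 ⟨e, h2⟩
  linear_combination h3

variable {ρ : G →* Equiv.Perm (ZMod (p ^ 2))} (hρ : IsAffineRep ρ)
  (htrans : ∀ z, ∃ σ, ρ σ 0 = z)
include hρ htrans

/-- A transitive group of affine maps of `ℤ/p²` has a normal subgroup, of elements whose linear
part is `1` modulo `p`, that is still transitive. -/
theorem exists_normal_transitive : ∃ U : Subgroup G, U.Normal ∧
    (∀ σ ∈ U, (p : ZMod (p ^ 2)) * hρ.linearPart σ = p) ∧ ∀ z, ∃ σ ∈ U, ρ σ 0 = z := by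
  have hp : p.Prime := Fact.out
  let χ : G →* (ZMod p)ˣ := MonoidHom.toHomUnits
    (((ZMod.castHom (dvd_pow_self p two_ne_zero) (ZMod p)) : ZMod (p ^ 2) →* ZMod p).comp
      hρ.linearPart)
  let : MulAction G (ZMod (p ^ 2)) := MulAction.compHom _ ρ
  have horb : MulAction.orbit G (0 : ZMod (p ^ 2)) = Set.univ :=
    Set.eq_univ_of_forall fun z => htrans z
  have hS : (MulAction.stabilizer G (0 : ZMod (p ^ 2))).index = p ^ 2 := by
    rw [MulAction.index_stabilizer, horb, Set.ncard_univ, Nat.card_zmod]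
  have hU : χ.ker.index ∣ p - 1 := by
    rw [Subgroup.index_ker, ← ZMod.card_units p, ← Nat.card_eq_fintype_card]
    exact Subgroup.card_subgroup_dvd_card _
  have hcop : Nat.Coprime (p ^ 2) (p - 1) := by
    refine Nat.Coprime.pow_left 2 ?_
    have := Nat.coprime_self_sub_right (m := 1) (n := p) hp.one_lt.le
    exact this.2 (Nat.coprime_one_right p)
  -- The index of the join divides both `p²` and `p - 1`.
  have hsup : χ.ker ⊔ MulAction.stabilizer G (0 : ZMod (p ^ 2)) = ⊤ := by
    rw [← Subgroup.index_eq_one]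
    refine Nat.eq_one_of_dvd_coprimes hcop ?_ ?_
    · exact (Subgroup.index_dvd_of_le le_sup_right).trans (dvd_of_eq hS)
    · exact (Subgroup.index_dvd_of_le le_sup_left).trans hU
  refine ⟨χ.ker, inferInstance, fun σ hσ => ?_, fun z => ?_⟩
  · exact prime_mul_of_castHom_eq_one (congrArg Units.val hσ)
  · obtain ⟨σ, rfl⟩ := htrans z
    obtain ⟨κ, hκ, s, hs, rfl⟩ := Subgroup.mem_sup_of_normal_left.1
      (hsup ▸ Subgroup.mem_top σ : σ ∈ χ.ker ⊔ MulAction.stabilizer G (0 : ZMod (p ^ 2)))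
    refine ⟨κ, hκ, ?_⟩
    rw [map_mul, Equiv.Perm.mul_apply, show ρ s 0 = 0 from hs]

variable (hinj : Function.Injective ρ)
include hinj

/-- The two cases are whether the stabiliser of `0` in the transitive normal subgroup `U` is
nontrivial. If it is, a power of a homothety corrects `κ` to a translation; if not, `U` is regular
and equals `⟨κ⟩`. -/
theorem exists_normal_zpowers (hodd : Odd p) :
    ∃ (q : G) (d : PrimeTorsion p), ρ q = tau d ∧ (Subgroup.zpowers q).Normal := by
  obtain ⟨U, hU, hlin, hUt⟩ := exists_normal_transitive hρ htrans
  obtain ⟨κ, hκ, hκ1⟩ := hUt 1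
  have htor : ∀ σ ∈ U, (p : ZMod (p ^ 2)) * (hρ.linearPart σ - 1) = 0 := fun σ hσ => by
    linear_combination hlin σ hσ
  by_cases h : ∃ s ∈ U, ρ s 0 = 0 ∧ hρ.linearPart s ≠ 1
  · obtain ⟨s, hs, hs0, hs1⟩ := h
    obtain ⟨e, he⟩ := (prime_mul_eq_zero_iff _).1 (htor s hs)
    obtain ⟨e', he'⟩ := (prime_mul_eq_zero_iff _).1 (htor κ hκ)
    have hunit : IsUnit e := isUnit_of_prime_mul_ne_zero (by
      rw [← he]; exact sub_ne_zero.2 hs1)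
    obtain ⟨i, hi⟩ := hunit.exists_right_inv
    -- The linear parts of `s` and `κ` are `1 + p e` and `1 + p e'`, so that of `κ sⁿ` is `1 + p (e'
    -- + n e)`; thus `n = -e'/e`.
    let n : ℕ := (-(i * e')).val
    have hn : (n : ZMod (p ^ 2)) = -(i * e') := ZMod.natCast_zmod_val _
    have hlinq : hρ.linearPart (κ * s ^ n) = 1 := by
      have h1 := one_add_pow (htor s hs) n
      rw [add_sub_cancel] at h1
      rw [map_mul, map_pow, h1, hn, he]
      linear_combination (1 + -(i * e') * (p * e)) * he' - p * e' * hi -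
        i * e' * e' * e * cast_prime_mul_self (p := p)
    have hs0n : ∀ n : ℕ, (ρ s ^ n) 0 = 0 := by
      intro n
      induction n with
      | zero => rfl
      | succ n ih => rw [pow_succ (ρ s) n, Equiv.Perm.mul_apply, hs0, ih]
    have hq : ρ (κ * s ^ n) = tau ⟨0, mul_zero _⟩ := by
      ext1 z
      rw [hρ.apply_eq_linearPart, hlinq, map_mul, map_pow, Equiv.Perm.mul_apply, hs0n, hκ1,
        tau_apply, add_zero]
    refine ⟨κ * s ^ n, _, hq, ⟨?_⟩⟩
    rintro _ ⟨k, rfl⟩ σ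
    change σ * (κ * s ^ n) ^ k * σ⁻¹ ∈ _
    rw [← conj_zpow]
    refine Subgroup.zpow_mem _ ?_ k
    have h2 := (conj_tau_mem_iff ⟨0, mul_zero _⟩ hodd _ _ _ (hρ.apply_eq_linearPart σ)).2
      (mul_zero _)
    rw [← hq, ← map_inv, ← map_mul, ← map_mul] at h2
    obtain ⟨l, hl⟩ := h2
    exact ⟨l, hinj (by rw [← hl]; exact map_zpow ρ _ l)⟩
  · push Not at h
    have hq : ρ κ = tau ⟨_, htor κ hκ⟩ := by
      ext1 z
      rw [hρ.apply_eq_linearPart, hκ1, tau_apply, add_sub_cancel]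
    refine ⟨κ, _, hq, ?_⟩
    have hUz : U = Subgroup.zpowers κ := by
      refine le_antisymm (fun σ hσ => ?_) (Subgroup.zpowers_le.2 hκ)
      obtain ⟨f, ⟨l, rfl⟩, hf⟩ := exists_zpowers_tau_apply ⟨_, htor κ hκ⟩ hodd (ρ σ 0)
      have hfix : ρ ((κ ^ l)⁻¹ * σ) 0 = 0 := by
        rw [map_mul, map_inv, map_zpow, hq, Equiv.Perm.mul_apply, ← hf]
        exact (tau _ ^ l).symm_apply_apply 0
      have hmem : (κ ^ l)⁻¹ * σ ∈ U := U.mul_mem (U.inv_mem (U.zpow_mem hκ l)) hσ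
      have hone : (κ ^ l)⁻¹ * σ = 1 := hinj (by
        ext1 z
        rw [hρ.apply_eq_linearPart, hfix, h _ hmem hfix, map_one]
        simp)
      rw [inv_mul_eq_one] at hone
      exact ⟨l, hone⟩
    exact hUz ▸ hU

/-- A regular normal subgroup has the stabiliser of `0` as a complement. That stabiliser acts by
homotheties, so it embeds in `(ℤ/p²)ˣ`, which is cyclic of order `p (p - 1)` because `p` is odd. -/
theorem exists_mulEquiv_semidirectProduct (hodd : Odd p) :
    ∃ m : ℕ, m ∣ p * (p - 1) ∧ ∃ φ : CyclicGrp m →* MulAut (CyclicGrp (p ^ 2)),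
      Nonempty (G ≃* CyclicGrp (p ^ 2) ⋊[φ] CyclicGrp m) := by
  have hp : p.Prime := Fact.out
  obtain ⟨q, d, hq, hnormal⟩ := exists_normal_zpowers hρ htrans hinj hodd
  let : MulAction G (ZMod (p ^ 2)) := MulAction.compHom _ ρ
  let S := MulAction.stabilizer G (0 : ZMod (p ^ 2))
  have hmap : ∀ σ ∈ Subgroup.zpowers q, ρ σ ∈ Subgroup.zpowers (tau d) := by
    rintro _ ⟨k, rfl⟩
    exact ⟨k, by rw [← hq]; exact (map_zpow ρ q k).symm⟩
  have hcompl : Subgroup.IsComplement' (Subgroup.zpowers q) S := by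
    refine Subgroup.isComplement'_stabilizer _ ?_ ?_
    · rintro ⟨σ, hσ⟩ h
      have h1 := (zpowers_tau_regular d hodd 0 0).unique (y₁ := ⟨ρ σ, hmap σ hσ⟩) (y₂ := 1) h rfl
      have h2 : ρ σ = 1 := congrArg Subtype.val h1
      exact Subtype.ext (hinj (h2.trans (map_one ρ).symm))
    · intro σ
      obtain ⟨f, ⟨l, rfl⟩, hf⟩ := exists_zpowers_tau_apply d hodd (ρ σ 0)
      refine ⟨⟨q ^ l, l, rfl⟩⁻¹, ?_⟩
      change ρ (q ^ l)⁻¹ (ρ σ 0) = 0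
      rw [← hf, map_inv, map_zpow, hq]
      exact (tau d ^ l).symm_apply_apply 0
  let θ : S →* (ZMod (p ^ 2))ˣ := MonoidHom.toHomUnits (hρ.linearPart.comp S.subtype)
  have hθ : Function.Injective θ := by
    rw [injective_iff_map_eq_one]
    rintro ⟨σ, hσ⟩ h
    have h1 : hρ.linearPart σ = 1 := congrArg Units.val h
    refine Subtype.ext (hinj ?_)
    ext1 z
    rw [hρ.apply_eq_linearPart, h1, show ρ σ 0 = 0 from hσ, one_mul, add_zero]
    exact (DFunLike.congr_fun (map_one ρ) z).symm
  have hcyc : IsCyclic (ZMod (p ^ 2))ˣ :=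
    ZMod.isCyclic_units_of_prime_pow p hp (fun h => by subst h; exact absurd hodd (by decide)) 2
  have hScyc : IsCyclic S := isCyclic_of_injective θ hθ
  have hSfin : Finite S := Finite.of_injective θ hθ
  have hScard : Nat.card S ∣ p * (p - 1) := by
    have h1 := Subgroup.card_dvd_of_injective θ hθ
    rw [Nat.card_eq_fintype_card (α := (ZMod (p ^ 2))ˣ), ZMod.card_units_eq_totient,
      Nat.totient_prime_pow_succ hp, pow_one] at h1
    exact h1
  have hqcard : Nat.card (Subgroup.zpowers q) = Nat.card (CyclicGrp (p ^ 2)) := by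
    rw [Nat.card_congr Multiplicative.toAdd, Nat.card_zmod, ← card_zpowers_tau d hodd,
      Nat.card_zpowers, Nat.card_zpowers, ← hq, orderOf_injective ρ hinj]
  have hScard' : Nat.card S = Nat.card (CyclicGrp (Nat.card S)) := by
    rw [Nat.card_congr Multiplicative.toAdd, Nat.card_zmod]
  exact ⟨Nat.card S, hScard, _, ⟨(SemidirectProduct.mulEquivSubgroup hcompl).symm.trans
    (SemidirectProduct.congr' (mulEquivOfCyclicCardEq hqcard) (mulEquivOfCyclicCardEq hScard'))⟩⟩

end Semidirect

/-! ### Transport of regular subgroups along a bijection. -/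

section Transport

variable {G X Y : Type*} [Group G] {ρ : G →* Equiv.Perm X}

theorem IsRegularNormalized.map_permCongrHom [Nonempty X] (ε : X ≃ Y) {N : Type*} [Group N]
    {Q : Subgroup (Equiv.Perm X)} (h : IsRegularNormalized ρ N Q) :
    IsRegularNormalized (ε.permCongrHom.toMonoidHom.comp ρ) N
      (Q.map ε.permCongrHom.toMonoidHom) := by
  obtain ⟨π, rfl, hreg, hnorm⟩ := h.exists_hom
  rw [MonoidHom.map_range]
  have : Nonempty Y := ε.nonempty_congr.1 inferInstance
  refine isRegularNormalized_range _ (fun x y => ?_) fun σ η => ?_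
  · obtain ⟨η, hη, huniq⟩ := hreg (ε.symm x) (ε.symm y)
    exact ⟨η, (Equiv.eq_symm_apply ε).1 hη, fun θ hθ => huniq θ ((Equiv.eq_symm_apply ε).2 hθ)⟩
  · obtain ⟨θ, hθ⟩ := hnorm σ η
    refine ⟨θ, ?_⟩
    simp only [MonoidHom.comp_apply, hθ, map_mul, map_inv]

theorem card_isRegularNormalized_permCongrHom [Nonempty X] (ε : X ≃ Y) {N : Type*} [Group N] :
    Nat.card {Q // IsRegularNormalized ρ N Q} =
      Nat.card {Q // IsRegularNormalized (ε.permCongrHom.toMonoidHom.comp ρ) N Q} := by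
  have : Nonempty Y := ε.nonempty_congr.1 inferInstance
  refine Nat.card_congr ((ε.permCongrHom.mapSubgroup).toEquiv.subtypeEquiv fun Q =>
    ⟨fun h => h.map_permCongrHom ε, fun h => ?_⟩)
  have h1 := h.map_permCongrHom ε.symm
  have hρ : ε.symm.permCongrHom.toMonoidHom.comp (ε.permCongrHom.toMonoidHom.comp ρ) = ρ := by
    ext σ x
    change ε.symm (ε (ρ σ (ε.symm (ε x)))) = _
    simp
  have hQ : (ε.permCongrHom.mapSubgroup Q).map ε.symm.permCongrHom.toMonoidHom = Q :=
    ε.permCongrHom.mapSubgroup.symm_apply_apply Q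
  rw [hρ] at h1
  exact hQ ▸ h1

end Transport

/-! ### Affine coordinates from a regular cyclic group. -/

section Coordinates

variable {G X : Type*} [Group G] [Nonempty X] {ρ : G →* Equiv.Perm X}

/-- A regular permutation representation of `ℤ/n` normalised by `ρ` identifies the set with `ℤ/n`,
turning `ρ` into a representation by affine maps. -/
theorem exists_affine_coordinates {n : ℕ} [NeZero n] (π : CyclicGrp n →* Equiv.Perm X)
    (hreg : ∀ x y, ∃! η, π η x = y) (hnorm : ∀ σ η, ∃ θ, π θ = ρ σ * π η * (ρ σ)⁻¹) :
    ∃ ε : X ≃ ZMod n, (∀ k x, ε (π (Multiplicative.ofAdd k) x) = ε x + k) ∧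
      ∀ σ, ∃ a b, ∀ z, ε (ρ σ (ε.symm z)) = a * z + b := by
  let x₀ : X := Classical.arbitrary X
  let ε' : ZMod n ≃ X := Equiv.ofBijective (fun z => π (Multiplicative.ofAdd z) x₀)
    ((Function.bijective_iff_existsUnique _).2 (hreg x₀))
  have hε : ∀ k x, ε'.symm (π (Multiplicative.ofAdd k) x) = ε'.symm x + k := by
    intro k x
    obtain ⟨z, rfl⟩ := ε'.surjective x
    rw [Equiv.symm_apply_apply, Equiv.symm_apply_eq]
    change π (Multiplicative.ofAdd k) (π (Multiplicative.ofAdd z) x₀) =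
      π (Multiplicative.ofAdd (z + k)) x₀
    rw [add_comm, ofAdd_add, map_mul, Equiv.Perm.mul_apply]
  refine ⟨ε'.symm, hε, fun σ => ?_⟩
  -- The conjugate of the unit translation is translation by `θ`, which becomes the slope of `ρ σ`.
  obtain ⟨θ, hθ⟩ := hnorm σ (Multiplicative.ofAdd 1)
  refine ⟨Multiplicative.toAdd θ, _, affine_of_apply_add_one _ _ fun z => ?_⟩
  have h1 : ε'.symm.symm (z + 1) = π (Multiplicative.ofAdd 1) (ε'.symm.symm z) := by
    rw [Equiv.symm_apply_eq, hε, Equiv.apply_symm_apply]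
  have h2 : ρ σ * π (Multiplicative.ofAdd 1) = π θ * ρ σ := by rw [hθ, inv_mul_cancel_right]
  rw [h1, ← Equiv.Perm.mul_apply, h2, Equiv.Perm.mul_apply]
  exact hε _ _

end Coordinates

/-! ### The normal cyclic factor acts regularly. -/

section SemidirectAction

theorem SemidirectProduct.conj_inl {N C : Type*} [CommGroup N] [Group C] {φ : C →* MulAut N}
    (g : N ⋊[φ] C) (n : N) : g * inl n * g⁻¹ = inl (φ g.right n) := by
  conv_lhs => rw [← inl_left_mul_inr_right g]
  rw [inl_aut, mul_inv_rev, ← map_inv, mul_assoc (inl g.left), mul_assoc (inl g.left),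
    ← mul_assoc _ _ (inl g.left)⁻¹, ← mul_assoc, ← inl_aut, ← map_inv, ← map_mul, ← map_mul,
    mul_inv_cancel_comm]

variable {G X : Type*} [Group G] {ρ : G →* Equiv.Perm X} {N C : Type*} [CommGroup N] [Group C]
  {φ : C →* MulAut N} (ψ : G ≃* N ⋊[φ] C)

theorem exists_conj_inl (σ : G) (η : N) : ∃ θ : N,
    ψ.symm (SemidirectProduct.inl θ) = σ * ψ.symm (SemidirectProduct.inl η) * σ⁻¹ := by
  refine ⟨φ (ψ σ).right η, ?_⟩
  rw [← SemidirectProduct.conj_inl, map_mul, map_mul, map_inv, ψ.symm_apply_apply]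

/-- A cyclic normal subgroup of a faithful transitive permutation group is regular if its order is
the degree. -/
theorem existsUnique_inl_apply [IsCyclic N] [Finite X]
    (hinj : Function.Injective ρ) (htrans : ∀ x y, ∃ σ, ρ σ x = y)
    (hcard : Nat.card N = Nat.card X) (x y : X) :
    ∃! η : N, ρ (ψ.symm (SemidirectProduct.inl η)) x = y := by
  have hfree : ∀ η : N, ρ (ψ.symm (SemidirectProduct.inl η)) x = x → η = 1 := by
    intro η hη
    have h1 : ρ (ψ.symm (SemidirectProduct.inl η)) = 1 := by
      ext y
      obtain ⟨σ, rfl⟩ := htrans x y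
      have hc := SemidirectProduct.conj_inl (ψ σ⁻¹) η
      -- An endomorphism of a cyclic group is a power map, so conjugates of `η` are powers of `η`.
      -- If `η` fixes `x`, it therefore fixes every point.
      obtain ⟨k, hk⟩ := MonoidHom.map_cyclic (φ (ψ σ⁻¹).right).toMonoidHom
      have h2 : σ⁻¹ * ψ.symm (SemidirectProduct.inl η) * σ =
          ψ.symm (SemidirectProduct.inl η) ^ k := by
        rw [← map_zpow, ← map_zpow, ← hk]
        apply ψ.injective
        rw [MulEquiv.apply_symm_apply]
        refine Eq.trans ?_ hc
        simp
      have h3 : ψ.symm (SemidirectProduct.inl η) * σ =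
          σ * ψ.symm (SemidirectProduct.inl η) ^ k := by
        rw [← h2]; group
      rw [← Equiv.Perm.mul_apply, ← map_mul, h3, map_mul, map_zpow, Equiv.Perm.mul_apply]
      exact congrArg _ (Equiv.Perm.zpow_apply_eq_self_of_apply_eq_self hη k)
    have h2 := hinj (h1.trans (map_one ρ).symm)
    exact SemidirectProduct.inl_injective (by simpa using h2)
  have hinj' : Function.Injective fun η : N => ρ (ψ.symm (SemidirectProduct.inl η)) x := by
    intro η θ h
    change ρ (ψ.symm (SemidirectProduct.inl η)) x = ρ (ψ.symm (SemidirectProduct.inl θ)) x at h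
    refine eq_of_inv_mul_eq_one (hfree (η⁻¹ * θ) ?_)
    rw [map_mul, map_mul, map_mul, Equiv.Perm.mul_apply, ← h, map_inv, map_inv, map_inv]
    exact Equiv.symm_apply_apply _ _
  exact (Function.bijective_iff_existsUnique _).1
    (hinj'.bijective_of_nat_card_le hcard.ge) y

end SemidirectAction

/-! ### Cyclic type in terms of the group structure of `G`. -/

section CyclicType

variable {p : ℕ} [Fact p.Prime] {G X : Type*} [Group G] [Finite X] [Nonempty X]
  {ρ : G →* Equiv.Perm X} (hinj : Function.Injective ρ) (htrans : ∀ x y, ∃ σ, ρ σ x = y)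
include hinj htrans

omit [Finite X] in
theorem IsRegularNormalized.exists_mulEquiv_semidirectProduct (hodd : Odd p)
    {Q : Subgroup (Equiv.Perm X)} (hQ : IsRegularNormalized ρ (CyclicGrp (p ^ 2)) Q) :
    ∃ m : ℕ, m ∣ p * (p - 1) ∧ ∃ φ : CyclicGrp m →* MulAut (CyclicGrp (p ^ 2)),
      Nonempty (G ≃* CyclicGrp (p ^ 2) ⋊[φ] CyclicGrp m) := by
  obtain ⟨π, -, hreg, hnorm⟩ := hQ.exists_hom
  obtain ⟨ε, -, haff⟩ := exists_affine_coordinates π hreg hnorm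
  refine _root_.exists_mulEquiv_semidirectProduct
    (ρ := ε.permCongrHom.toMonoidHom.comp ρ) haff (fun z => ?_)
    (ε.permCongrHom.injective.comp hinj) hodd
  obtain ⟨σ, hσ⟩ := htrans (ε.symm 0) (ε.symm z)
  exact ⟨σ, (Equiv.eq_symm_apply ε).1 hσ⟩

variable {C : Type*} [Group C] {φ : C →* MulAut (CyclicGrp (p ^ 2))}
  (ψ : G ≃* CyclicGrp (p ^ 2) ⋊[φ] C)
include ψ

omit [Fact p.Prime] in
theorem exists_isRegularNormalized (hcard : Nat.card X = p ^ 2) :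
    ∃ Q, IsRegularNormalized ρ (CyclicGrp (p ^ 2)) Q :=
  ⟨_, isRegularNormalized_range ((ρ.comp ψ.symm.toMonoidHom).comp SemidirectProduct.inl)
    (existsUnique_inl_apply ψ hinj htrans (by
      rw [Nat.card_congr Multiplicative.toAdd, Nat.card_zmod, hcard]))
    (fun σ η => by
      obtain ⟨θ, hθ⟩ := exists_conj_inl ψ σ η
      exact ⟨θ, by simpa using congrArg ρ hθ⟩)⟩

/-- Coordinates are taken from the normal `C_{p²}` inside `G`, so that the image of `G` contains all
translations. -/
theorem exists_translation_coordinates (hcard : Nat.card X = p ^ 2) :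
    ∃ ε : X ≃ ZMod (p ^ 2), IsAffineRep (ε.permCongrHom.toMonoidHom.comp ρ) ∧
      ∀ k z, ε.permCongrHom.toMonoidHom.comp ρ
        (ψ.symm (SemidirectProduct.inl (Multiplicative.ofAdd k))) z = z + k := by
  obtain ⟨ε, htrl, haff⟩ := exists_affine_coordinates (ρ := ρ)
    ((ρ.comp ψ.symm.toMonoidHom).comp SemidirectProduct.inl)
    (existsUnique_inl_apply ψ hinj htrans (by
      rw [Nat.card_congr Multiplicative.toAdd, Nat.card_zmod, hcard]))
    (fun σ η => by
      obtain ⟨θ, hθ⟩ := exists_conj_inl ψ σ η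
      exact ⟨θ, by simpa using congrArg ρ hθ⟩)
  refine ⟨ε, haff, fun k z => ?_⟩
  have := htrl k (ε.symm z)
  rwa [Equiv.apply_symm_apply] at this

end CyclicType

/-! ### Linear parts and the complement `C`. -/

section Translations

variable {p : ℕ} [Fact p.Prime] {G : Type*} [Group G] {ρ : G →* Equiv.Perm (ZMod (p ^ 2))}
  (hinj : Function.Injective ρ) (hρ : IsAffineRep ρ)
  {C : Type*} [Group C] {φ : C →* MulAut (CyclicGrp (p ^ 2))}
  (ψ : G ≃* CyclicGrp (p ^ 2) ⋊[φ] C)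
  (htrl : ∀ k z, ρ (ψ.symm (SemidirectProduct.inl (Multiplicative.ofAdd k))) z = z + k)
include hinj htrl

omit [Fact p.Prime] in
theorem linearPart_eq_one_iff (σ : G) : hρ.linearPart σ = 1 ↔ (ψ σ).right = 1 := by
  constructor
  · intro h
    have h1 : σ = ψ.symm (SemidirectProduct.inl (Multiplicative.ofAdd (ρ σ 0))) := hinj (by
      ext1 z
      rw [htrl, hρ.apply_eq_linearPart, h, one_mul])
    rw [h1, ψ.apply_symm_apply, SemidirectProduct.right_inl]
  · intro h
    have h1 : σ = ψ.symm (SemidirectProduct.inl (ψ σ).left) := by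
      rw [MulEquiv.eq_symm_apply]
      ext <;> simp [h]
    have h2 : ∀ z, ρ σ z = z + Multiplicative.toAdd (ψ σ).left := fun z => by
      conv_lhs => rw [h1]
      exact htrl _ z
    change ρ σ 1 - ρ σ 0 = 1
    rw [h2, h2]
    ring

-- An element of `ker φ` commutes with the unit translation, hence is itself a translation, and so
-- has trivial component in `C`.
omit [Fact p.Prime] in
include hρ in
theorem semidirectProduct_hom_injective : Function.Injective φ := by
  rw [injective_iff_map_eq_one]
  intro c hc
  set σ := ψ.symm (SemidirectProduct.inr c) with hσ
  set t := ψ.symm (SemidirectProduct.inl (Multiplicative.ofAdd 1)) with ht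
  have hcomm : σ * t = t * σ := by
    rw [hσ, ht, ← map_mul, ← map_mul]
    congr 1
    ext <;> simp [hc]
  have h1 : ρ σ 1 = ρ σ 0 + 1 := by
    rw [← htrl 1, ← ht, ← Equiv.Perm.mul_apply, ← map_mul, ← hcomm, map_mul,
      Equiv.Perm.mul_apply, ht, htrl, zero_add]
  have h2 : hρ.linearPart σ = 1 := by
    change ρ σ 1 - ρ σ 0 = 1
    rw [h1, add_sub_cancel_left]
  rw [linearPart_eq_one_iff hinj hρ ψ htrl, hσ, ψ.apply_symm_apply] at h2
  exact h2

/-- The linear part factors faithfully through `C`. If `a = 1 + d` with `p d = 0`, then `aᵖ = 1 + p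
d = 1`; conversely `aᵖ = 1` gives `p a = p aᵖ = p`. -/
theorem forall_prime_mul_linearPart_iff :
    (∀ σ, (p : ZMod (p ^ 2)) * hρ.linearPart σ = p) ↔ ∀ c : C, c ^ p = 1 := by
  have hright : ∀ (σ : G) (n : ℕ), (ψ (σ ^ n)).right = (ψ σ).right ^ n := fun σ n => by
    rw [map_pow]; exact map_pow SemidirectProduct.rightHom _ n
  constructor
  · intro h c
    set σ := ψ.symm (SemidirectProduct.inr c) with hσ
    have h1 := one_add_pow (d := hρ.linearPart σ - 1) (by linear_combination h σ) p
    rw [add_sub_cancel, ← map_pow, mul_sub, h σ, mul_one, sub_self, add_zero,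
      linearPart_eq_one_iff hinj hρ ψ htrl, hright, hσ, ψ.apply_symm_apply] at h1
    exact h1
  · intro h σ
    rw [← prime_mul_pow_prime, ← map_pow, (linearPart_eq_one_iff hinj hρ ψ htrl _).2
      (by rw [hright, h]), mul_one]

end Translations

theorem CyclicGrp.forall_pow_eq_one_iff {m n : ℕ} :
    (∀ c : CyclicGrp m, c ^ n = 1) ↔ m ∣ n := by
  rw [← ZMod.natCast_eq_zero_iff]
  constructor
  · intro h
    have := congrArg Multiplicative.toAdd (h (Multiplicative.ofAdd 1))
    simpa using this
  · intro h c
    apply Multiplicative.toAdd.injective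
    rw [toAdd_pow, nsmul_eq_mul, h, zero_mul, toAdd_one]

/-- The criterion that all linear parts be `1` modulo `p` says that `C_m` has exponent dividing `p`,
that is `m ∣ p`. -/
theorem card_isRegularNormalized_of_mulEquiv {p : ℕ} [Fact p.Prime] (hodd : Odd p)
    {G X : Type*} [Group G] [Finite X] [Nonempty X]
    {ρ : G →* Equiv.Perm X} (hinj : Function.Injective ρ) (htrans : ∀ x y, ∃ σ, ρ σ x = y)
    (hcard : Nat.card X = p ^ 2) {m : ℕ} {φ : CyclicGrp m →* MulAut (CyclicGrp (p ^ 2))}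
    (ψ : G ≃* CyclicGrp (p ^ 2) ⋊[φ] CyclicGrp m) :
    Function.Injective φ ∧ Nat.card {Q // IsRegularNormalized ρ (CyclicGrp (p ^ 2)) Q} =
      if m = 1 ∨ m = p then p else 1 := by
  obtain ⟨ε, hρ, htrl⟩ := exists_translation_coordinates hinj htrans ψ hcard
  have hinj' : Function.Injective (ε.permCongrHom.toMonoidHom.comp ρ) :=
    ε.permCongrHom.injective.comp hinj
  refine ⟨semidirectProduct_hom_injective hinj' hρ ψ htrl, ?_⟩
  rw [card_isRegularNormalized_permCongrHom ε]
  refine card_isRegularNormalized hρ hodd _ (htrl 1) ?_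
  rw [forall_prime_mul_linearPart_iff hinj' hρ ψ htrl, CyclicGrp.forall_pow_eq_one_iff,
    Nat.dvd_prime Fact.out]

end

theorem theorem4p3 (p : ℕ) (hp : p.Prime) (hp_odd : Odd p)
    (K : Type u) (L : Type v) (M : Type w) [Field K] [Field L] [Field M]
    [Algebra K L] [Algebra K M]
    [Algebra.IsSeparable K L] (hdeg : Module.finrank K L = p ^ 2)
    [IsNormalClosure K L M] :
    ((∃ S : HopfGaloisStructure K L, S.HasType M (CyclicGrp (p ^ 2))) ↔
      ∃ m : ℕ, m ∣ p * (p - 1) ∧ ∃ φ : CyclicGrp m →* MulAut (CyclicGrp (p ^ 2)),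
        Nonempty (Gal(M/K) ≃* CyclicGrp (p ^ 2) ⋊[φ] CyclicGrp m)) ∧
    ∀ m : ℕ, m ∣ p * (p - 1) → ∀ φ : CyclicGrp m →* MulAut (CyclicGrp (p ^ 2)),
      Nonempty (Gal(M/K) ≃* CyclicGrp (p ^ 2) ⋊[φ] CyclicGrp m) →
        Function.Injective φ ∧
        HopfGaloisStructure.numberOfType K L M (CyclicGrp (p ^ 2)) =
          if m = 1 ∨ m = p then p else 1 := by
  have : Fact p.Prime := ⟨hp⟩
  have : FiniteDimensional K L :=
    FiniteDimensional.of_finrank_pos (by rw [hdeg]; exact pow_pos hp.pos 2)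
  have hX : Nat.card (L →ₐ[K] M) = p ^ 2 := by rw [card_embeddings, hdeg]
  have hX' : 0 < Nat.card (L →ₐ[K] M) := by rw [hX]; exact pow_pos hp.pos 2
  obtain ⟨_, _⟩ := Nat.card_pos_iff.1 hX'
  have hN : Nat.card (CyclicGrp (p ^ 2)) = Module.finrank K L := by
    rw [Nat.card_congr Multiplicative.toAdd, Nat.card_zmod, hdeg]
  have hinj : Function.Injective (galPerm K L M) := galPerm_injective
  have htrans : ∀ x y, ∃ σ, galPerm K L M σ x = y := galPerm_transitive
  refine ⟨?_, ?_⟩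
  · rw [exists_hasType_iff hN]
    constructor
    · rintro ⟨Q, hQ⟩
      exact hQ.exists_mulEquiv_semidirectProduct hinj htrans hp_odd
    · rintro ⟨m, -, φ, ⟨ψ⟩⟩
      exact exists_isRegularNormalized hinj htrans ψ hX
  · rintro m - φ ⟨ψ⟩
    rw [numberOfType_eq_card hN]
    exact card_isRegularNormalized_of_mulEquiv hp_odd hinj htrans hX ψ
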